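/- Let $n\ge 1$, $c\in\mathbb R^n$ and $a_0,\dots,a_n:[0,2\pi]\to\mathbb R$. Consider the linear semi-infinite program $$(P)\quad \min c^{\top}x\quad\text{s.t.}\quad \sum_{j=1}^n a_j(t)x_j\le a_0(t)\quad \forall t\in[0,2\pi].$$ For a program $(\cdot)$ let $F(\cdot)$, $S(\cdot)$, $v(\cdot)$ be its feasible set, its set of optimal solutions and its optimal value; $\|\cdot\|$ is the Euclidean norm and $d(x,F)$ the distance from $x$ to the set $F$. Put $$a_{j,k}=\frac1{2\pi}\int_0^{2\pi}a_j(t)e^{ikt}\,dt=r_{j,k}+i\,s_{j,k}\quad(r_{j,k},s_{j,k}\in\mathbb R),\qquad \hat a_j^K(t)=\sum_{k=-K}^{K}a_{j,k}e^{-ikt},$$ which is real valued. For $R,A\in\mathbb R$ define the programs $$(FP_K)\quad \min c^{\top}x\quad\text{s.t.}\quad \sum_{j=1}^n\hat a_j^K(t)x_j\le\hat a_0^K(t)\quad\forall t\in[0,2\pi],$$ $$(AFP_K)\quad \min c^{\top}x\quad\text{s.t.}\quad \sum_{j=1}^n\hat a_j^K(t)x_j\le\hat a_0^K(t)+2(nR+1)A\frac{\ln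 K}{K}\quad\forall t\in[0,2\pi].$$ Let $C_{1,j}$ ($0\le j\le K$) and $C_{2,j}$ ($1\le j\le K$) be the real $(K+1)\times(K+1)$ matrices with $(C_{1,j})_{k,l}=1$ if $|k-l|=j$ and $0$ otherwise, and $(C_{2,j})_{k,l}=1$ if $l-k=j$, $-1$ if $k-l=j$, and $0$ otherwise, and put $$\bar C_{1,j}=\begin{pmatrix}C_{1,j}&0\\0&C_{1,j}\end{pmatrix},\qquad \bar C_{2,j}=\begin{pmatrix}0&-C_{2,j}\\C_{2,j}&0\end{pmatrix}.$$ Let $E_{j,0}=r_{j,0}$, $E_{j,k}=r_{j,k}+r_{j,-k}$ and $F_{j,k}=s_{j,k}-s_{j,-k}$ for $1\le j\le n$, $1\le k\le K$; let $p_0=r_{0,0}$, $p_k=r_{0,k}+r_{0,-k}$ and $q_k=s_{0,k}-s_{0,-k}$ for $1\le k\le K$. Then $(TFP_K)$ is the real semidefinite program in $x\in\mathbb R^n$ and a symmetric $Y\in\mathbb R^{2(K+1)\times 2(K+1)}$ $$(TFP_K)\quad\min c^{\top}x\quad\text{s.t.}\quad \operatorname{Tr}(\bar C_{1,k}Y)+(E^{\top}x)_k-p_k=0\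 (0\le k\le K),\quad \operatorname{Tr}(\bar C_{2,k}Y)-(F^{\top}x)_k+q_k=0\ (1\le k\le K),\quad Y\succeq0 .$$ **Theorem.** Assume that (i) every $a_j$, $0\le j\le n$, is Lipschitz continuous on $[0,2\pi]$ and $a_j(0)=a_j(2\pi)$; (ii) Slater's condition holds for $(P)$: there is $\hat x$ with $\sum_{j}a_j(t)\hat x_j<a_0(t)$ for all $t\in[0,2\pi]$; (iii) there are $\tilde x\in\mathbb R^n$ and $Q<0$ with $\sum_{j}a_j(t)\tilde x_j\le Q$ for all $t\in[0,2\pi]$; (iv) $c\ne0$, $S(P)\ne\emptyset$, and $\|x\|\le R$ for all $x\in S(P)$. Then there is $A>0$ with $$|a_j(t)-\hat a_j^K(t)|\le A\frac{\ln K}{K}\qquad\text{for all }t\in[0,2\pi],\ 0\le j\le n,\ K\ge2, \tag{1}$$ and: (a) for all large enough $K$, Slater's condition holds for $(FP_K)$: some $x$ satisfies $\sum_j\hat a_j^K(t)x_j<\hat a_0^K(t)$ for all $t\in[0,2\pi]$; (b) for every $A>0$ satisfying (1) there is a constant $L>0$, independent of $K$, such that for all large enough $K$ every $x\in S(AFP_K)$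 satisfies $$|c^{\top}x-v(P)|\le L\frac{\ln K}{K}\quad\text{and}\quad d(x,F(P))\le L\frac{\ln K}{K}; \tag{2}$$ (c) there is a constant $L>0$, independent of $K$, such that for all large enough $K$ every $x\in S(FP_K)$ satisfies (2); (d) there is a constant $L>0$, independent of $K$, such that for all large enough $K$ and every $(x,Y)\in S(TFP_K)$, $x$ satisfies (2). -/

import Mathlib

namespace TrigSIP

noncomputable section

/-- The linear objective `cᵀ x`. -/
def objective {n : ℕ} (c x : EuclideanSpace ℝ (Fin n)) : ℝ :=
  ∑ j, c j * x j

/-- Feasible set of the linear semi-infinite program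
`∑ j, b j t * x j ≤ b₀ t` for all `t ∈ [0, 2π]`. -/
def feasibleSet {n : ℕ} (b : Fin n → ℝ → ℝ) (b₀ : ℝ → ℝ) : Set (EuclideanSpace ℝ (Fin n)) :=
  {x | ∀ t ∈ Set.Icc (0 : ℝ) (2 * Real.pi), ∑ j, b j t * x j ≤ b₀ t}

/-- Slater's condition: some point satisfies every constraint strictly. -/
def Slater {n : ℕ} (b : Fin n → ℝ → ℝ) (b₀ : ℝ → ℝ) : Prop :=
  ∃ x : EuclideanSpace ℝ (Fin n),
    ∀ t ∈ Set.Icc (0 : ℝ) (2 * Real.pi), ∑ j, b j t * x j < b₀ t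

/-- The set of minimizers of `cᵀ x` over a feasible set `F`. -/
def solutionSet {n : ℕ} (c : EuclideanSpace ℝ (Fin n)) (F : Set (EuclideanSpace ℝ (Fin n))) :
    Set (EuclideanSpace ℝ (Fin n)) :=
  {x | x ∈ F ∧ ∀ y ∈ F, objective c x ≤ objective c y}

/-- The optimal value (infimum) of `cᵀ x` over a feasible set `F`. -/
def optimalValue {n : ℕ} (c : EuclideanSpace ℝ (Fin n)) (F : Set (EuclideanSpace ℝ (Fin n))) : ℝ :=
  sInf (objective c '' F)

/-- `x` is `ε`-optimal, with constant `L`, for minimizing `cᵀ x` over `F`. -/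
def IsEpsOptimal {n : ℕ} (c : EuclideanSpace ℝ (Fin n)) (F : Set (EuclideanSpace ℝ (Fin n)))
    (L ε : ℝ) (x : EuclideanSpace ℝ (Fin n)) : Prop :=
  |objective c x - optimalValue c F| ≤ L * ε ∧ Metric.infDist x F ≤ L * ε

/-- The Fourier coefficient `(1 / 2π) ∫_0^{2π} f(t) e^{ikt} dt`. -/
def coeff (f : ℝ → ℝ) (k : ℤ) : ℂ :=
  (1 / (2 * (Real.pi : ℂ))) *
    ∫ t in (0 : ℝ)..(2 * Real.pi), (f t : ℂ) * Complex.exp (Complex.I * k * t)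

/-- The truncated Fourier series `∑_{|k| ≤ K} a_k e^{-ikt}`, as a complex number. -/
def truncC (f : ℝ → ℝ) (K : ℕ) (t : ℝ) : ℂ :=
  ∑ k ∈ Finset.Icc (-(K : ℤ)) K, coeff f k * Complex.exp (-(Complex.I * k * t))

/-- The truncated Fourier series as a real function; see `ofReal_trunc`. -/
def trunc (f : ℝ → ℝ) (K : ℕ) (t : ℝ) : ℝ :=
  (truncC f K t).re

theorem conj_coeff (f : ℝ → ℝ) (k : ℤ) :
    (starRingEnd ℂ) (coeff f k) = coeff f (-k) := by
  unfold coeff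
  rw [map_mul, ← intervalIntegral.intervalIntegral_conj]
  congr 1
  · simp [map_ofNat]
  · refine intervalIntegral.integral_congr fun t _ => ?_
    simp [← Complex.exp_conj]

/-- Truncated Fourier series of real functions are real valued. -/
theorem ofReal_trunc (f : ℝ → ℝ) (K : ℕ) (t : ℝ) : (trunc f K t : ℂ) = truncC f K t := by
  refine Complex.conj_eq_iff_re.mp ?_
  unfold truncC
  rw [map_sum]
  refine Finset.sum_nbij' (fun k => -k) (fun k => -k) ?_ ?_ ?_ ?_ ?_
  · intro k hk
    simp only [Finset.mem_Icc] at hk ⊢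
    omega
  · intro k hk
    simp only [Finset.mem_Icc] at hk ⊢
    omega
  · simp
  · simp
  · intro k _
    rw [map_mul, conj_coeff, ← Complex.exp_conj]
    simp

/-- `A` is a constant in the uniform bound `|f_j - trunc f_j K| ≤ A ln K / K`
on `[0, 2π]`, for all functions `f_j` of the family and all `K ≥ 2`. -/
def IsTruncErrorConst {m : ℕ} (f : Fin m → ℝ → ℝ) (A : ℝ) : Prop :=
  0 < A ∧ ∀ K : ℕ, 2 ≤ K → ∀ j, ∀ t ∈ Set.Icc (0 : ℝ) (2 * Real.pi),
    |f j t - trunc (f j) K t| ≤ A * (Real.log K / K)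

/- The three semi-infinite programs: the original one, its Fourier truncation, and the
relaxation of the latter. The data are `a 0` (right-hand side) and `a 1, …, a n`. -/

/-- Feasible set of the original program (P). -/
def feasP {n : ℕ} (a : Fin (n + 1) → ℝ → ℝ) : Set (EuclideanSpace ℝ (Fin n)) :=
  feasibleSet (fun j => a j.succ) (a 0)

/-- Feasible set of the Fourier-truncated program (FP_K). -/
def feasFP {n : ℕ} (a : Fin (n + 1) → ℝ → ℝ) (K : ℕ) : Set (EuclideanSpace ℝ (Fin n)) :=
  feasibleSet (fun j => trunc (a j.succ) K) (trunc (a 0) K)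

/-- Feasible set of the relaxed program (AFP_K), with slack `2 (n R + 1) A ln K / K`. -/
def feasAFP {n : ℕ} (a : Fin (n + 1) → ℝ → ℝ) (R A : ℝ) (K : ℕ) :
    Set (EuclideanSpace ℝ (Fin n)) :=
  feasibleSet (fun j => trunc (a j.succ) K)
    (fun t => trunc (a 0) K t + 2 * (n * R + 1) * A * (Real.log K / K))

/- The real semidefinite program (TFP_K). -/

/-- `(C_{1,j})_{k,l} = 1` if `|k - l| = j`, and `0` otherwise. -/
def C1 (K : ℕ) (j : Fin (K + 1)) : Matrix (Fin (K + 1)) (Fin (K + 1)) ℝ :=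
  Matrix.of fun k l => if |((k : ℕ) : ℤ) - ((l : ℕ) : ℤ)| = ((j : ℕ) : ℤ) then 1 else 0

/-- With `j' = j + 1 ∈ {1, …, K}`: `(C_{2,j'})_{k,l}` is `1` if `l - k = j'`,
`-1` if `k - l = j'`, and `0` otherwise. -/
def C2 (K : ℕ) (j : Fin K) : Matrix (Fin (K + 1)) (Fin (K + 1)) ℝ :=
  Matrix.of fun k l =>
    if (l : ℕ) = (k : ℕ) + ((j : ℕ) + 1) then 1
    else if (k : ℕ) = (l : ℕ) + ((j : ℕ) + 1) then -1 else 0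

/-- The block matrix with rows `(C_{1,j}, 0)` and `(0, C_{1,j})`. -/
def C1bar (K : ℕ) (j : Fin (K + 1)) :
    Matrix (Fin (K + 1) ⊕ Fin (K + 1)) (Fin (K + 1) ⊕ Fin (K + 1)) ℝ :=
  Matrix.fromBlocks (C1 K j) 0 0 (C1 K j)

/-- The block matrix with rows `(0, -C_{2,j})` and `(C_{2,j}, 0)`. -/
def C2bar (K : ℕ) (j : Fin K) :
    Matrix (Fin (K + 1) ⊕ Fin (K + 1)) (Fin (K + 1) ⊕ Fin (K + 1)) ℝ :=
  Matrix.fromBlocks 0 (-(C2 K j)) (C2 K j) 0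

/-- For a family `C` of square matrices, `C Y` is the vector with entries `Tr (C_j Y)`. -/
def applyFamily {ι m : Type*} [Fintype m] (C : ι → Matrix m m ℝ) (Y : Matrix m m ℝ) : ι → ℝ :=
  fun j => (C j * Y).trace

/-- `r_0` for `k = 0` and `r_k + r_{-k}` for `k = 1, …, K`,
where `r_k` is the real part of the Fourier coefficient. -/
def cosVec (f : ℝ → ℝ) (K : ℕ) : Fin (K + 1) → ℝ :=
  fun k => if (k : ℕ) = 0 then (coeff f 0).re
    else (coeff f ((k : ℕ) : ℤ)).re + (coeff f (-((k : ℕ) : ℤ))).re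

/-- `s_k - s_{-k}` for `k = 1, …, K` (indexed from `0`),
where `s_k` is the imaginary part of the Fourier coefficient. -/
def sinVec (f : ℝ → ℝ) (K : ℕ) : Fin K → ℝ :=
  fun k => (coeff f (((k : ℕ) : ℤ) + 1)).im - (coeff f (-(((k : ℕ) : ℤ) + 1))).im

/-- The vector `p^K`. -/
def pVec {n : ℕ} (a : Fin (n + 1) → ℝ → ℝ) (K : ℕ) : Fin (K + 1) → ℝ :=
  cosVec (a 0) K

/-- The vector `q^K`. -/
def qVec {n : ℕ} (a : Fin (n + 1) → ℝ → ℝ) (K : ℕ) : Fin K → ℝ :=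
  sinVec (a 0) K

/-- The matrix `E^K`. -/
def EMat {n : ℕ} (a : Fin (n + 1) → ℝ → ℝ) (K : ℕ) : Matrix (Fin n) (Fin (K + 1)) ℝ :=
  Matrix.of fun j k => cosVec (a j.succ) K k

/-- The matrix `F^K`. -/
def FMat {n : ℕ} (a : Fin (n + 1) → ℝ → ℝ) (K : ℕ) : Matrix (Fin n) (Fin K) ℝ :=
  Matrix.of fun j k => sinVec (a j.succ) K k

/-- Feasible set of (TFP_K), in the variables `(x, Y)`:
`C1bar Y + Eᵀ x - p = 0`, `C2bar Y - Fᵀ x + q = 0`, `Y ⪰ 0`. -/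
def feasTFP {n : ℕ} (a : Fin (n + 1) → ℝ → ℝ) (K : ℕ) :
    Set (EuclideanSpace ℝ (Fin n) ×
      Matrix (Fin (K + 1) ⊕ Fin (K + 1)) (Fin (K + 1) ⊕ Fin (K + 1)) ℝ) :=
  {z | applyFamily (C1bar K) z.2 + Matrix.mulVec (EMat a K).transpose z.1.ofLp - pVec a K = 0 ∧
    applyFamily (C2bar K) z.2 - Matrix.mulVec (FMat a K).transpose z.1.ofLp + qVec a K = 0 ∧
    z.2.PosSemidef}

/-- Optimal solutions `(x, Y)` of (TFP_K): feasible pairs that minimize `cᵀ x`. -/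
def solTFP {n : ℕ} (c : EuclideanSpace ℝ (Fin n)) (a : Fin (n + 1) → ℝ → ℝ) (K : ℕ) :
    Set (EuclideanSpace ℝ (Fin n) ×
      Matrix (Fin (K + 1) ⊕ Fin (K + 1)) (Fin (K + 1) ⊕ Fin (K + 1)) ℝ) :=
  {z | z ∈ feasTFP a K ∧ ∀ u ∈ feasTFP a K, objective c z.1 ≤ objective c u.1}

end

end TrigSIP

/-!
Truncating the Fourier series of the data perturbs every constraint by `O(ln K / K)`, uniformly in
`t` and for `x` in a bounded set, and the program is stable under such perturbations.

*Truncation error.* A Lipschitz function with equal end values has a Lipschitz periodic extension,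
and `trunc f K t - f t` is the integral of `f (t + u) - f t` against the Dirichlet kernel. The
translation `u ↦ u + π / (K + 1/2)` changes the sign of the oscillating factor
`sin ((K + 1/2) u)`, so the integrand nearly cancels against its translate, the remainder being of
size `h / dist (u, 2πℤ)` with `h = π / (K + 1/2)`; integrating gives `O(ln K / K)`
(`abs_trunc_sub_le_of_lipschitz`).

*Stability.* Since the solution set is bounded, objective and constraints are jointly coercive
(`exists_coercive`), so near-optimal points of the perturbed programs lie in a fixed ball. There
they violate the original constraints by `O(ln K / K)`, and adding `O(ln K / K)` times a
direction `x'`, along which all constraints decrease at rate at least `|Q|`, makes them feasible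
(`exists_isEpsOptimal_of_almost_feasible`). The same move applied to an optimal solution gives a
Slater point of the truncated program with nearly optimal value
(`exists_slater_point_near_optimal`).

*Semidefinite program.* By Fejér–Riesz a trigonometric polynomial of degree `K` is nonnegative iff
it has a positive semidefinite Gram matrix of order `K + 1`, so the truncated program is the
projection of the semidefinite one (`mem_feasFP_iff`). Fejér–Riesz is needed only as a sum of
squares, and then an induction on the degree suffices: subtract the minimum, which is a square;
what is left has a zero on the circle, necessarily double, and division by `|z - z₀|²` lowers the
degree (`exists_sum_normSq_of_nonneg`).
-/

/-! ### Truncated Fourier series and the Dirichlet kernel -/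

namespace TrigSIP
open Finset

/-- The Dirichlet kernel `∑_{|k| ≤ K} e^{iku} = 1 + 2 ∑_{k=1}^K cos (k u)`. -/
noncomputable def dirichletKernel (K : ℕ) (u : ℝ) : ℝ :=
  1 + 2 * ∑ k ∈ range K, Real.cos ((k + 1) * u)

theorem continuous_dirichletKernel (K : ℕ) : Continuous (dirichletKernel K) := by
  unfold dirichletKernel
  fun_prop

theorem dirichletKernel_mul_sin (K : ℕ) (u : ℝ) :
    dirichletKernel K u * Real.sin (u / 2) = Real.sin ((K + 1 / 2) * u) := by
  induction K with
  | zero => simp [dirichletKernel]; ring_nf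
  | succ K ih =>
    have h : dirichletKernel (K + 1) u = dirichletKernel K u + 2 * Real.cos ((K + 1) * u) := by
      simp only [dirichletKernel, sum_range_succ]; ring
    rw [h, add_mul, ih]
    have e1 : ((K : ℝ) + 1 / 2) * u = (K + 1) * u - u / 2 := by ring
    have e2 : (((K + 1 : ℕ) : ℝ) + 1 / 2) * u = (K + 1) * u + u / 2 := by push_cast; ring
    rw [e1, e2, Real.sin_sub, Real.sin_add]
    ring

theorem periodic_dirichletKernel (K : ℕ) :
    Function.Periodic (dirichletKernel K) (2 * Real.pi) := by
  intro u
  unfold dirichletKernel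
  congr 2
  refine sum_congr rfl fun k _ => ?_
  have := Real.cos_add_nat_mul_two_pi (((k : ℝ) + 1) * u) (k + 1)
  rw [← this]
  push_cast
  ring_nf

theorem integral_dirichletKernel (K : ℕ) :
    ∫ u in (0 : ℝ)..(2 * Real.pi), dirichletKernel K u = 2 * Real.pi := by
  unfold dirichletKernel
  rw [intervalIntegral.integral_add (by simp) (Continuous.intervalIntegrable (by fun_prop) _ _),
    intervalIntegral.integral_const_mul, intervalIntegral.integral_finsetSum
      (fun k _ => Continuous.intervalIntegrable (by fun_prop) _ _)]
  have : ∀ k ∈ range K, ∫ u in (0 : ℝ)..(2 * Real.pi), Real.cos (((k : ℝ) + 1) * u) = 0 := by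
    intro k _
    have hk : ((k : ℝ) + 1) ≠ 0 := by positivity
    rw [intervalIntegral.integral_comp_mul_left (fun x => Real.cos x) hk, integral_cos]
    have := Real.sin_nat_mul_pi (2 * (k + 1))
    push_cast at this
    rw [show ((k : ℝ) + 1) * (2 * Real.pi) = 2 * (k + 1) * Real.pi by ring, this]
    simp
  rw [sum_eq_zero this]
  simp

theorem coeff_congr {f g : ℝ → ℝ} (h : Set.EqOn f g (Set.Icc 0 (2 * Real.pi))) (k : ℤ) :
    coeff f k = coeff g k := by
  unfold coeff
  congr 1
  refine intervalIntegral.integral_congr fun t ht => ?_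
  rw [Set.uIcc_of_le (by positivity)] at ht
  simp only [h ht]

theorem trunc_congr {f g : ℝ → ℝ} (h : Set.EqOn f g (Set.Icc 0 (2 * Real.pi))) (K : ℕ) (t : ℝ) :
    trunc f K t = trunc g K t := by
  simp only [trunc, truncC, coeff_congr h]

theorem coeff_eq {f : ℝ → ℝ} (hf : Continuous f) (k : ℤ) :
    coeff f k = (((2 * Real.pi)⁻¹ * ∫ s in (0 : ℝ)..(2 * Real.pi), f s * Real.cos (k * s) : ℝ) : ℂ)
      + (((2 * Real.pi)⁻¹ * ∫ s in (0 : ℝ)..(2 * Real.pi), f s * Real.sin (k * s) : ℝ) : ℂ)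
        * Complex.I := by
  have h : ∀ t : ℝ, (f t : ℂ) * Complex.exp (Complex.I * k * t) =
      ((f t * Real.cos (k * t) : ℝ) : ℂ) + ((f t * Real.sin (k * t) : ℝ) : ℂ) * Complex.I := by
    intro t
    rw [show Complex.I * k * t = ((k * t : ℝ) : ℂ) * Complex.I by push_cast; ring,
      Complex.exp_mul_I]
    push_cast
    ring
  unfold coeff
  simp only [h]
  rw [intervalIntegral.integral_add (Continuous.intervalIntegrable (by fun_prop) _ _)
    (Continuous.intervalIntegrable (by fun_prop) _ _), intervalIntegral.integral_mul_const,
    intervalIntegral.integral_ofReal, intervalIntegral.integral_ofReal]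
  push_cast
  ring

theorem trunc_eq_sum (f : ℝ → ℝ) (K : ℕ) (t : ℝ) :
    trunc f K t = (coeff f 0).re + ∑ k ∈ range K,
      2 * ((coeff f (k + 1)).re * Real.cos ((k + 1) * t)
        + (coeff f (k + 1)).im * Real.sin ((k + 1) * t)) := by
  have hterm : ∀ k : ℤ, (coeff f k * Complex.exp (-(Complex.I * k * t))).re =
      (coeff f k).re * Real.cos (k * t) + (coeff f k).im * Real.sin (k * t) := by
    intro k
    rw [show -(Complex.I * k * t) = ((-(k * t) : ℝ) : ℂ) * Complex.I by push_cast; ring,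
      Complex.mul_re, Complex.exp_ofReal_mul_I_re, Complex.exp_ofReal_mul_I_im]
    simp
  induction K with
  | zero => simp [trunc, truncC]
  | succ K ih =>
    have hs : Icc (-((K + 1 : ℕ) : ℤ)) ((K + 1 : ℕ) : ℤ) =
        insert (-((K : ℤ) + 1)) (insert ((K : ℤ) + 1) (Icc (-(K : ℤ)) K)) := by
      ext k
      simp only [mem_Icc, mem_insert]
      push_cast
      omega
    rw [sum_range_succ, ← add_assoc, ← ih]
    unfold trunc truncC
    rw [hs, sum_insert (by simp; omega), sum_insert (by simp), Complex.add_re, Complex.add_re,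
      hterm, hterm]
    have hre : (coeff f (-((K : ℤ) + 1))).re = (coeff f ((K : ℤ) + 1)).re := by
      rw [← conj_coeff, Complex.conj_re]
    have him : (coeff f (-((K : ℤ) + 1))).im = -(coeff f ((K : ℤ) + 1)).im := by
      rw [← conj_coeff, Complex.conj_im]
    rw [hre, him]
    push_cast
    rw [neg_mul, Real.cos_neg, Real.sin_neg]
    ring

theorem trunc_eq_integral {f : ℝ → ℝ} (hf : Continuous f) (K : ℕ) (t : ℝ) :
    trunc f K t = (2 * Real.pi)⁻¹ *
      ∫ s in (0 : ℝ)..(2 * Real.pi), f s * dirichletKernel K (s - t) := by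
  have h : ∀ s, f s * dirichletKernel K (s - t) = f s + ∑ k ∈ range K,
      (2 * Real.cos ((k + 1) * t) * (f s * Real.cos ((k + 1) * s)) +
        2 * Real.sin ((k + 1) * t) * (f s * Real.sin ((k + 1) * s))) := by
    intro s
    rw [dirichletKernel, mul_add, mul_one, ← mul_assoc, mul_sum]
    congr 1
    refine sum_congr rfl fun k _ => ?_
    rw [mul_sub, Real.cos_sub]
    ring
  simp only [h]
  rw [intervalIntegral.integral_add (hf.intervalIntegrable _ _)
    (Continuous.intervalIntegrable (by fun_prop) _ _),
    intervalIntegral.integral_finsetSum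
      (fun k _ => Continuous.intervalIntegrable (by fun_prop) _ _), trunc_eq_sum, mul_add, mul_sum]
  congr 1
  · simp [coeff_eq hf]
  refine sum_congr rfl fun k _ => ?_
  rw [intervalIntegral.integral_add (Continuous.intervalIntegrable (by fun_prop) _ _)
    (Continuous.intervalIntegrable (by fun_prop) _ _), intervalIntegral.integral_const_mul,
    intervalIntegral.integral_const_mul, coeff_eq hf]
  simp only [Complex.add_re, Complex.add_im, Complex.ofReal_re, Complex.ofReal_im,
    Complex.re_ofReal_mul, Complex.im_ofReal_mul, Complex.I_re, Complex.I_im]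
  push_cast
  ring

/-- The truncation error of a periodic function as an integral of its increments against the
Dirichlet kernel. -/
theorem trunc_sub_eq_integral {f : ℝ → ℝ} (hf : Continuous f)
    (hper : Function.Periodic f (2 * Real.pi)) (K : ℕ) (t : ℝ) :
    trunc f K t - f t = (2 * Real.pi)⁻¹ *
      ∫ u in (0 : ℝ)..(2 * Real.pi), (f (t + u) - f t) * dirichletKernel K u := by
  have hD := continuous_dirichletKernel K
  have hpi := Real.pi_pos.ne'
  have h1 : ∫ s in (0 : ℝ)..(2 * Real.pi), f s * dirichletKernel K (s - t) =
      ∫ u in (0 : ℝ)..(2 * Real.pi), f (t + u) * dirichletKernel K u := by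
    have hp : Function.Periodic (fun s => f s * dirichletKernel K (s - t)) (2 * Real.pi) := by
      intro s
      simp only
      rw [hper, add_sub_right_comm, periodic_dirichletKernel]
    have h2 := hp.intervalIntegral_add_eq 0 t
    rw [zero_add] at h2
    rw [h2]
    have h3 := intervalIntegral.integral_comp_add_left (a := 0) (b := 2 * Real.pi)
      (fun s => f s * dirichletKernel K (s - t)) t
    simp only [add_sub_cancel_left, add_zero] at h3
    exact h3.symm
  simp only [sub_mul]
  rw [intervalIntegral.integral_sub (Continuous.intervalIntegrable (by fun_prop) _ _)
    (Continuous.intervalIntegrable (by fun_prop) _ _), intervalIntegral.integral_const_mul,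
    integral_dirichletKernel, trunc_eq_integral hf, h1]
  field_simp

end TrigSIP

/-! ### Truncation error of Lipschitz functions -/

namespace TrigSIP
open Finset

theorem min_le_pi_mul_sin_half {v : ℝ} (h0 : 0 ≤ v) (h1 : v ≤ 2 * Real.pi) :
    min v (2 * Real.pi - v) ≤ Real.pi * Real.sin (v / 2) := by
  have hpi := Real.pi_pos
  rcases le_total v Real.pi with h | h
  · have := Real.mul_le_sin (x := v / 2) (by linarith) (by linarith)
    have h2 : 2 / Real.pi * (v / 2) * Real.pi = v := by field_simp
    have := mul_le_mul_of_nonneg_right this hpi.le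
    exact (min_le_left _ _).trans (by linarith)
  · have := Real.mul_le_sin (x := Real.pi - v / 2) (by linarith) (by linarith)
    have h2 : 2 / Real.pi * (Real.pi - v / 2) * Real.pi = 2 * Real.pi - v := by field_simp
    have := mul_le_mul_of_nonneg_right this hpi.le
    rw [Real.sin_pi_sub] at this
    exact (min_le_right _ _).trans (by linarith)

section Increment

variable {f : ℝ → ℝ} {M : ℝ}

theorem abs_increment_le_sin_half (hM : 0 ≤ M) (hper : Function.Periodic f (2 * Real.pi))
    (hL : ∀ x y, |f x - f y| ≤ M * |x - y|) (t : ℝ) {u : ℝ} (h0 : 0 ≤ u)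
    (h1 : u ≤ 2 * Real.pi) : |f (t + u) - f t| ≤ M * (Real.pi * Real.sin (u / 2)) := by
  refine le_trans ?_ (mul_le_mul_of_nonneg_left (min_le_pi_mul_sin_half h0 h1) hM)
  rcases min_choice u (2 * Real.pi - u) with h | h <;> rw [h]
  · have := hL (t + u) t
    rwa [add_sub_cancel_left, abs_of_nonneg h0] at this
  · have := hL (t + u) (t + 2 * Real.pi)
    rwa [hper, show t + u - (t + 2 * Real.pi) = -(2 * Real.pi - u) by ring, abs_neg,
      abs_of_nonneg (a := 2 * Real.pi - u) (by linarith)] at this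

theorem abs_increment_mul_dirichletKernel_le (hM : 0 ≤ M)
    (hper : Function.Periodic f (2 * Real.pi))
    (hL : ∀ x y, |f x - f y| ≤ M * |x - y|) (K : ℕ) (t : ℝ) {u : ℝ} (h0 : 0 ≤ u)
    (h1 : u ≤ 2 * Real.pi) :
    |(f (t + u) - f t) * dirichletKernel K u| ≤ M * Real.pi := by
  have hs := abs_increment_le_sin_half hM hper hL t h0 h1
  have hs0 : 0 ≤ Real.sin (u / 2) := Real.sin_nonneg_of_nonneg_of_le_pi (by linarith) (by linarith)
  rcases hs0.eq_or_lt with h | h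
  · rw [← h] at hs
    have : f (t + u) - f t = 0 := abs_nonpos_iff.mp (by linarith)
    rw [this, zero_mul, abs_zero]
    positivity
  · refine le_of_mul_le_mul_right ?_ h
    calc |(f (t + u) - f t) * dirichletKernel K u| * Real.sin (u / 2)
        = |f (t + u) - f t| * |dirichletKernel K u * Real.sin (u / 2)| := by
          rw [abs_mul, abs_mul, abs_of_pos h]; ring
      _ ≤ M * (Real.pi * Real.sin (u / 2)) * 1 := by
          rw [dirichletKernel_mul_sin]
          exact mul_le_mul hs (Real.abs_sin_le_one _) (abs_nonneg _) (by positivity)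
      _ = _ := by ring

/-- Translation by half a period of `sin ((K + 1/2) u)` reverses the sign of this factor, so the
integrand nearly cancels against its translate. -/
theorem abs_add_translate_le (hM : 0 ≤ M) (hper : Function.Periodic f (2 * Real.pi))
    (hL : ∀ x y, |f x - f y| ≤ M * |x - y|) (K : ℕ) (t : ℝ) {u h : ℝ}
    (hh : (K + 1 / 2) * h = Real.pi) (h0 : 0 < h) (hu0 : 0 < u) (hu1 : u + h < 2 * Real.pi) :
    |(f (t + u) - f t) * dirichletKernel K u +
      (f (t + (u + h)) - f t) * dirichletKernel K (u + h)| ≤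
      3 * Real.pi * M * h * ((u + h)⁻¹ + (2 * Real.pi - (u + h))⁻¹) := by
  set s₁ := Real.sin (u / 2) with hs₁
  set s₂ := Real.sin ((u + h) / 2) with hs₂
  set S := Real.sin ((K + 1 / 2) * u) with hS
  set d₁ := f (t + u) - f t with hd₁
  set d₂ := f (t + (u + h)) - f t with hd₂
  have hp₁ : 0 < s₁ := Real.sin_pos_of_pos_of_lt_pi (by linarith) (by linarith)
  have hp₂ : 0 < s₂ := Real.sin_pos_of_pos_of_lt_pi (by linarith) (by linarith)
  have e₁ : dirichletKernel K u * s₁ = S := dirichletKernel_mul_sin K u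
  have e₂ : dirichletKernel K (u + h) * s₂ = -S := by
    rw [hs₂, dirichletKernel_mul_sin, mul_add, hh, Real.sin_add_pi]
  have b₁ : |d₁| ≤ M * (Real.pi * s₁) :=
    abs_increment_le_sin_half hM hper hL t hu0.le (by linarith)
  have b₂ : |s₂ - s₁| ≤ h / 2 := by
    have := Real.abs_sin_sub_sin_le ((u + h) / 2) (u / 2)
    rwa [show (u + h) / 2 - u / 2 = h / 2 by ring, abs_of_pos (a := h / 2) (by linarith)] at this
  have b₃ : |d₁ - d₂| ≤ M * h := by
    have := hL (t + u) (t + (u + h))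
    rwa [show t + u - (t + (u + h)) = -h by ring, abs_neg, abs_of_pos h0,
      show f (t + u) - f (t + (u + h)) = d₁ - d₂ by ring] at this
  have key : |d₁ * dirichletKernel K u + d₂ * dirichletKernel K (u + h)| * s₂ ≤ 3 * M * h := by
    refine le_of_mul_le_mul_right ?_ hp₁
    have e : (d₁ * dirichletKernel K u + d₂ * dirichletKernel K (u + h)) * s₂ * s₁ =
        S * (d₁ * (s₂ - s₁) + (d₁ - d₂) * s₁) := by
      linear_combination d₁ * s₂ * e₁ + d₂ * s₁ * e₂
    rw [← abs_of_pos hp₂, ← abs_mul]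
    nth_rewrite 1 [← abs_of_pos hp₁]
    rw [← abs_mul, e, abs_mul]
    have h1 : |d₁ * (s₂ - s₁)| ≤ M * (Real.pi * s₁) * (h / 2) := by
      rw [abs_mul]; exact mul_le_mul b₁ b₂ (abs_nonneg _) (by positivity)
    have h2 : |(d₁ - d₂) * s₁| ≤ M * h * s₁ := by
      rw [abs_mul, abs_of_pos hp₁]; exact mul_le_mul_of_nonneg_right b₃ hp₁.le
    have hMhs : 0 ≤ M * h * s₁ := by positivity
    calc |S| * |d₁ * (s₂ - s₁) + (d₁ - d₂) * s₁|
        ≤ 1 * (M * (Real.pi * s₁) * (h / 2) + M * h * s₁) :=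
          mul_le_mul (Real.abs_sin_le_one _) ((abs_add_le _ _).trans (add_le_add h1 h2))
            (abs_nonneg _) zero_le_one
      _ ≤ 3 * M * h * s₁ := by nlinarith [Real.pi_le_four]
  have hv : 0 < u + h := by linarith
  have hw : 0 < 2 * Real.pi - (u + h) := by linarith
  have hinv : s₂⁻¹ ≤ Real.pi * ((u + h)⁻¹ + (2 * Real.pi - (u + h))⁻¹) := by
    have hmin := min_le_pi_mul_sin_half hv.le hu1.le
    have hm : 0 < min (u + h) (2 * Real.pi - (u + h)) := lt_min hv hw
    have h1 : (min (u + h) (2 * Real.pi - (u + h)))⁻¹ ≤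
        (u + h)⁻¹ + (2 * Real.pi - (u + h))⁻¹ := by
      have := inv_pos.mpr hv
      have := inv_pos.mpr hw
      rcases min_choice (u + h) (2 * Real.pi - (u + h)) with h | h <;> rw [h] <;> linarith
    refine le_trans ?_ (mul_le_mul_of_nonneg_left h1 Real.pi_pos.le)
    rw [← div_eq_mul_inv, inv_le_iff_one_le_mul₀ hp₂, div_mul_eq_mul_div, le_div_iff₀ hm, one_mul]
    exact hmin
  calc _ = |d₁ * dirichletKernel K u + d₂ * dirichletKernel K (u + h)| * s₂ * s₂⁻¹ := by
        field_simp
    _ ≤ 3 * M * h * (Real.pi * ((u + h)⁻¹ + (2 * Real.pi - (u + h))⁻¹)) :=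
        mul_le_mul key hinv (by positivity) (by positivity)
    _ = _ := by ring

theorem integral_inv_add_inv_le {h : ℝ} (h0 : 0 < h) (h1 : 3 * h ≤ 2 * Real.pi) :
    ∫ u in h..(2 * Real.pi - 2 * h), ((u + h)⁻¹ + (2 * Real.pi - (u + h))⁻¹) ≤
      2 * Real.log (2 * Real.pi / h) := by
  have hle : h ≤ 2 * Real.pi - 2 * h := by linarith
  have hc1 : ContinuousOn (fun u : ℝ => (u + h)⁻¹) (Set.uIcc h (2 * Real.pi - 2 * h)) := by
    refine ContinuousOn.inv₀ (by fun_prop) fun u hu => ?_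
    rw [Set.uIcc_of_le hle] at hu
    linarith [hu.1]
  have hc2 : ContinuousOn (fun u : ℝ => (2 * Real.pi - (u + h))⁻¹)
      (Set.uIcc h (2 * Real.pi - 2 * h)) := by
    refine ContinuousOn.inv₀ (by fun_prop) fun u hu => ?_
    rw [Set.uIcc_of_le hle] at hu
    linarith [hu.2]
  rw [intervalIntegral.integral_add hc1.intervalIntegrable hc2.intervalIntegrable]
  have e1 : ∫ u in h..(2 * Real.pi - 2 * h), (u + h)⁻¹ =
      Real.log ((2 * Real.pi - h) / (2 * h)) := by
    rw [intervalIntegral.integral_comp_add_right (fun x => x⁻¹),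
      integral_inv_of_pos (by linarith) (by linarith)]
    congr 2 <;> ring
  have e2 : ∫ u in h..(2 * Real.pi - 2 * h), (2 * Real.pi - (u + h))⁻¹ =
      Real.log ((2 * Real.pi - 2 * h) / h) := by
    have : ∀ u : ℝ, 2 * Real.pi - (u + h) = (2 * Real.pi - h) - u := fun u => by ring
    simp only [this]
    rw [intervalIntegral.integral_comp_sub_left (fun x => x⁻¹),
      integral_inv_of_pos (by linarith) (by linarith)]
    congr 2 <;> ring
  rw [e1, e2]
  have l1 : Real.log ((2 * Real.pi - h) / (2 * h)) ≤ Real.log (2 * Real.pi / h) := by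
    refine Real.log_le_log (div_pos (by linarith) (by linarith)) ?_
    exact div_le_div₀ (by linarith) (by linarith) h0 (by linarith)
  have l2 : Real.log ((2 * Real.pi - 2 * h) / h) ≤ Real.log (2 * Real.pi / h) := by
    refine Real.log_le_log (div_pos (by linarith) h0) ?_
    exact div_le_div₀ (by linarith) (by linarith) h0 le_rfl
  linarith

theorem abs_trunc_sub_le_of_lipschitz (hM : 0 ≤ M) (hper : Function.Periodic f (2 * Real.pi))
    (hL : ∀ x y, |f x - f y| ≤ M * |x - y|) {K : ℕ} (hK : 2 ≤ K) (t : ℝ) :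
    |f t - trunc f K t| ≤ 100 * M * (Real.log K / K) := by
  have hpi := Real.pi_pos
  have hpi4 := Real.pi_le_four
  have hK' : (2 : ℝ) ≤ K := by exact_mod_cast hK
  have hcont : Continuous f := by
    refine (LipschitzWith.of_dist_le_mul (K := M.toNNReal) fun x y => ?_).continuous
    rw [Real.coe_toNNReal M hM]
    exact hL x y
  set h : ℝ := Real.pi / (K + 1 / 2) with hh
  have hN : (0 : ℝ) < K + 1 / 2 := by linarith
  have h0 : 0 < h := by positivity
  have hNh : (K + 1 / 2) * h = Real.pi := by rw [hh]; field_simp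
  have hhK : h * K ≤ Real.pi := by nlinarith
  have h3 : 3 * h ≤ 2 * Real.pi := by nlinarith
  set φ : ℝ → ℝ := fun u => (f (t + u) - f t) * dirichletKernel K u with hφ
  have hφc : Continuous φ := by
    have := continuous_dirichletKernel K
    fun_prop
  have hφi : ∀ a b, IntervalIntegrable φ MeasureTheory.volume a b :=
    fun a b => hφc.intervalIntegrable a b
  have hφb : ∀ a b, 0 ≤ a → a ≤ b → b ≤ 2 * Real.pi →
      |∫ u in a..b, φ u| ≤ M * Real.pi * (b - a) := by
    intro a b ha hab hb
    have := intervalIntegral.norm_integral_le_of_norm_le_const (f := φ) (a := a) (b := b)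
      (C := M * Real.pi) fun u hu => by
        rw [Set.uIoc_of_le hab] at hu
        exact abs_increment_mul_dirichletKernel_le hM hper hL K t (by linarith [hu.1])
          (by linarith [hu.2])
    rwa [Real.norm_eq_abs, abs_of_nonneg (a := b - a) (by linarith)] at this
  have hlog : Real.log (2 * Real.pi / h) ≤ 3 * Real.log K := by
    have e : 2 * Real.pi / h = 2 * K + 1 := by rw [hh]; field_simp
    rw [e, show 3 * Real.log K = Real.log ((K : ℝ) ^ 3) by rw [Real.log_pow]; norm_num]
    refine Real.log_le_log (by linarith) ?_
    nlinarith [mul_nonneg (sub_nonneg.mpr hK') (sub_nonneg.mpr hK'),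
      mul_nonneg (mul_nonneg (sub_nonneg.mpr hK') (sub_nonneg.mpr hK')) (sub_nonneg.mpr hK')]
  have hmid : |∫ u in h..(2 * Real.pi - 2 * h), (φ u + φ (u + h))| ≤
      3 * Real.pi * M * h * (2 * (3 * Real.log K)) := by
    have hle : h ≤ 2 * Real.pi - 2 * h := by linarith
    have hint : IntervalIntegrable
        (fun u : ℝ => 3 * Real.pi * M * h * ((u + h)⁻¹ + (2 * Real.pi - (u + h))⁻¹))
        MeasureTheory.volume h (2 * Real.pi - 2 * h) := by
      refine ContinuousOn.intervalIntegrable (continuousOn_const.mul (ContinuousOn.add ?_ ?_)) <;>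
      · refine ContinuousOn.inv₀ (by fun_prop) fun u hu => ?_
        rw [Set.uIcc_of_le hle] at hu
        linarith [hu.1, hu.2]
    have := intervalIntegral.norm_integral_le_of_norm_le (f := fun u => φ u + φ (u + h)) hle
      (Filter.Eventually.of_forall fun u hu =>
        abs_add_translate_le hM hper hL K t hNh h0 (by linarith [hu.1]) (by linarith [hu.2])) hint
    rw [Real.norm_eq_abs, intervalIntegral.integral_const_mul] at this
    refine this.trans (mul_le_mul_of_nonneg_left ?_ (by positivity))
    exact (integral_inv_add_inv_le h0 h3).trans (by linarith)
  -- one copy of the integral is cut at `h` and `2π - 2h`, the other at `2h` and `2π - h`, so that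
  -- their middle parts are translates of each other
  have hsplit : 2 * ∫ u in (0 : ℝ)..(2 * Real.pi), φ u =
      (∫ u in (0 : ℝ)..h, φ u) + (∫ u in (2 * Real.pi - 2 * h)..(2 * Real.pi), φ u) +
      (∫ u in (0 : ℝ)..(2 * h), φ u) + (∫ u in (2 * Real.pi - h)..(2 * Real.pi), φ u) +
      ∫ u in h..(2 * Real.pi - 2 * h), (φ u + φ (u + h)) := by
    rw [intervalIntegral.integral_add (hφi _ _)
      (Continuous.intervalIntegrable (u := fun u => φ (u + h))
        (hφc.comp (continuous_add_const h)) _ _), intervalIntegral.integral_comp_add_right φ h,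
      show h + h = 2 * h by ring, show 2 * Real.pi - 2 * h + h = 2 * Real.pi - h by ring]
    have a1 := intervalIntegral.integral_add_adjacent_intervals (hφi 0 h)
      (hφi h (2 * Real.pi - 2 * h))
    have a2 := intervalIntegral.integral_add_adjacent_intervals (hφi 0 (2 * Real.pi - 2 * h))
      (hφi _ (2 * Real.pi))
    have a3 := intervalIntegral.integral_add_adjacent_intervals (hφi 0 (2 * h))
      (hφi _ (2 * Real.pi - h))
    have a4 := intervalIntegral.integral_add_adjacent_intervals (hφi 0 (2 * Real.pi - h))
      (hφi _ (2 * Real.pi))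
    linarith
  have hI : |∫ u in (0 : ℝ)..(2 * Real.pi), φ u| ≤
      3 * Real.pi * M * h + 9 * Real.pi * M * h * Real.log K := by
    have b1 := hφb 0 h le_rfl h0.le (by linarith)
    have b2 := hφb (2 * Real.pi - 2 * h) (2 * Real.pi) (by linarith) (by linarith) le_rfl
    have b3 := hφb 0 (2 * h) le_rfl (by linarith) (by linarith)
    have b4 := hφb (2 * Real.pi - h) (2 * Real.pi) (by linarith) (by linarith) le_rfl
    rw [abs_le] at *
    constructor <;> linarith [b1.1, b1.2, b2.1, b2.2, b3.1, b3.2, b4.1, b4.2, hmid.1, hmid.2]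
  have hlogK : 1 / 2 ≤ Real.log K := by
    have := Real.log_le_log two_pos hK'
    linarith [Real.log_two_gt_d9]
  rw [abs_sub_comm, trunc_sub_eq_integral hcont hper, abs_mul, abs_of_pos (a := (2 * Real.pi)⁻¹)
    (by positivity), ← mul_div_assoc, le_div_iff₀ (by linarith)]
  calc _ ≤ (2 * Real.pi)⁻¹ * (3 * Real.pi * M * h + 9 * Real.pi * M * h * Real.log K) * K := by
        gcongr
    _ = 3 / 2 * M * (h * K) + 9 / 2 * M * (h * K) * Real.log K := by field_simp
    _ = 3 / 2 * M * (h * K) * (1 + 3 * Real.log K) := by ring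
    _ ≤ 3 / 2 * M * 4 * (5 * Real.log K) :=
        mul_le_mul (mul_le_mul_of_nonneg_left (hhK.trans hpi4) (by positivity)) (by linarith)
          (by linarith) (by positivity)
    _ ≤ _ := by nlinarith [mul_nonneg hM (by linarith : 0 ≤ Real.log K)]

end Increment

/-- The periodic extension of a Lipschitz function on `[0, 2π]` with equal end values is
Lipschitz with the same constant. -/
theorem exists_periodic_lipschitz_extension {f : ℝ → ℝ} {M : NNReal}
    (hf : LipschitzOnWith M f (Set.Icc (0 : ℝ) (2 * Real.pi))) (h0 : f 0 = f (2 * Real.pi)) :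
    ∃ g : ℝ → ℝ, Function.Periodic g (2 * Real.pi) ∧
      Set.EqOn f g (Set.Icc 0 (2 * Real.pi)) ∧ ∀ x y, |g x - g y| ≤ M * |x - y| := by
  have hp : (0 : ℝ) < 2 * Real.pi := by positivity
  have hf' : ∀ x ∈ Set.Icc (0 : ℝ) (2 * Real.pi), ∀ y ∈ Set.Icc (0 : ℝ) (2 * Real.pi),
      |f x - f y| ≤ M * |x - y| := fun x hx y hy => hf.dist_le_mul x hx y hy
  refine ⟨fun x => f (toIcoMod hp 0 x), fun x => ?_, fun x hx => ?_, ?_⟩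
  · simp only [toIcoMod_add_right]
  · rcases hx.2.eq_or_lt with h | h
    · rw [h]
      have : toIcoMod hp 0 (2 * Real.pi) = 0 := by
        simpa using toIcoMod_apply_right hp (0 : ℝ)
      simp only [this, h0]
    · simp only
      rw [(toIcoMod_eq_self hp).mpr ⟨hx.1, by simpa using h⟩]
  · have main : ∀ x y, x ≤ y →
        |f (toIcoMod hp 0 x) - f (toIcoMod hp 0 y)| ≤ M * |x - y| := by
      intro x y hxy
      have hx := toIcoMod_mem_Ico hp 0 x
      have hy := toIcoMod_mem_Ico hp 0 y
      have ex := toIcoMod_add_toIcoDiv_zsmul hp 0 x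
      have ey := toIcoMod_add_toIcoDiv_zsmul hp 0 y
      set x₀ := toIcoMod hp 0 x
      set y₀ := toIcoMod hp 0 y
      set k := toIcoDiv hp 0 x
      set l := toIcoDiv hp 0 y
      rw [zero_add, Set.mem_Ico] at hx hy
      rw [zsmul_eq_mul] at ex ey
      rw [abs_sub_comm x y, abs_of_nonneg (a := y - x) (by linarith)]
      have mx : x₀ ∈ Set.Icc (0 : ℝ) (2 * Real.pi) := ⟨hx.1, hx.2.le⟩
      have my : y₀ ∈ Set.Icc (0 : ℝ) (2 * Real.pi) := ⟨hy.1, hy.2.le⟩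
      rcases lt_trichotomy k l with h | h | h
      · -- go from `x₀` up to `2π`, then from `0` up to `y₀`
        have h1 : (k : ℝ) + 1 ≤ l := by exact_mod_cast h
        have b1 := hf' x₀ mx (2 * Real.pi) ⟨hp.le, le_rfl⟩
        have b2 := hf' 0 ⟨le_rfl, hp.le⟩ y₀ my
        rw [abs_sub_comm x₀, abs_of_nonneg (a := 2 * Real.pi - x₀) (by linarith)] at b1
        rw [zero_sub, abs_neg, abs_of_nonneg hy.1, h0] at b2
        calc |f x₀ - f y₀| ≤ M * (2 * Real.pi - x₀) + M * y₀ :=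
              (abs_sub_le _ (f (2 * Real.pi)) _).trans (add_le_add b1 b2)
          _ = M * (2 * Real.pi - x₀ + y₀) := by ring
          _ ≤ M * (y - x) := by
              refine mul_le_mul_of_nonneg_left ?_ M.2
              nlinarith
      · have := hf' x₀ mx y₀ my
        rw [h] at ex
        have e : y - x = y₀ - x₀ := by linarith
        rwa [abs_sub_comm x₀, ← e, abs_of_nonneg (a := y - x) (by linarith)] at this
      · exfalso
        have h1 : (l : ℝ) + 1 ≤ k := by exact_mod_cast h
        nlinarith
    intro x y
    rcases le_total x y with h | h
    · exact main x y h
    · rw [abs_sub_comm, abs_sub_comm x y]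
      exact main y x h

/-- Lipschitz functions with equal end values have uniform truncation error `O(ln K / K)`. -/
theorem exists_isTruncErrorConst {m : ℕ} {a : Fin m → ℝ → ℝ}
    (hLip : ∀ j, ∃ M : NNReal, LipschitzOnWith M (a j) (Set.Icc (0 : ℝ) (2 * Real.pi)))
    (hper : ∀ j, a j 0 = a j (2 * Real.pi)) : ∃ A : ℝ, IsTruncErrorConst a A := by
  choose M hM using hLip
  refine ⟨1 + ∑ j, 100 * (M j : ℝ), by positivity, fun K hK j t ht => ?_⟩
  obtain ⟨g, hg, heq, hgL⟩ := exists_periodic_lipschitz_extension (hM j) (hper j)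
  rw [heq ht, trunc_congr heq]
  refine (abs_trunc_sub_le_of_lipschitz (M j).coe_nonneg hg hgL hK t).trans ?_
  have hlog : 0 ≤ Real.log K / K := div_nonneg (Real.log_natCast_nonneg K) (Nat.cast_nonneg K)
  refine mul_le_mul_of_nonneg_right ?_ hlog
  have := single_le_sum (f := fun j => 100 * (M j : ℝ)) (fun i _ => by positivity) (mem_univ j)
  exact this.trans (by linarith)

end TrigSIP

/-! ### Fejér–Riesz as a sum of squares -/

namespace TrigSIP
open Finset Polynomial ComplexConjugate ComplexOrder

/-- If `z ↦ z̄^K P(z)` is real and nonnegative on the unit circle, its zeros there are double. -/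
theorem eval_derivative_eq_zero_of_nonneg {P : ℂ[X]} {K : ℕ}
    (hpos : ∀ z : ℂ, ‖z‖ = 1 → ∃ r : ℝ, 0 ≤ r ∧ P.eval z = z ^ K * r)
    {z₀ : ℂ} (hz₀ : ‖z₀‖ = 1) (h0 : P.eval z₀ = 0) : P.derivative.eval z₀ = 0 := by
  obtain ⟨t₀, ht₀⟩ : ∃ t : ℝ, Complex.exp (t * Complex.I) = z₀ :=
    ⟨Complex.arg z₀, by simpa [hz₀] using Complex.norm_mul_exp_arg_mul_I z₀⟩
  have hn : ∀ t : ℝ, ‖Complex.exp (t * Complex.I)‖ = 1 := Complex.norm_exp_ofReal_mul_I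
  choose r hr using fun t : ℝ => hpos _ (hn t)
  have hz : ∀ t : ℝ, Complex.exp (t * Complex.I) ≠ 0 := fun t => Complex.exp_ne_zero _
  -- `F` is the trigonometric polynomial as a function of the angle; it has a minimum at `t₀`
  set F : ℂ → ℂ := fun w => P.eval (Complex.exp (w * Complex.I)) *
    Complex.exp (-(K * (w * Complex.I))) with hF
  have hFr : ∀ t : ℝ, F t = r t := by
    intro t
    simp only [hF]
    rw [(hr t).2, Complex.exp_neg, Complex.exp_nat_mul]
    field_simp [hz t]
  have hFd : HasDerivAt F (P.derivative.eval z₀ * (z₀ * Complex.I) *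
      Complex.exp (-(K * (t₀ * Complex.I)))) (t₀ : ℂ) := by
    have h1 : HasDerivAt (fun w : ℂ => Complex.exp (w * Complex.I))
        (z₀ * Complex.I) (t₀ : ℂ) := by
      have := ((hasDerivAt_id (t₀ : ℂ)).mul_const Complex.I).cexp
      simpa [ht₀] using this
    have h2 : HasDerivAt (fun w : ℂ => P.eval (Complex.exp (w * Complex.I)))
        (P.derivative.eval z₀ * (z₀ * Complex.I)) (t₀ : ℂ) := by
      have h3 := P.hasDerivAt (Complex.exp (t₀ * Complex.I))
      have := h3.comp (t₀ : ℂ) h1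
      rwa [ht₀] at this
    have h4 : HasDerivAt (fun w : ℂ => Complex.exp (-(K * (w * Complex.I))))
        (Complex.exp (-(K * (t₀ * Complex.I))) * (-(K * (1 * Complex.I)))) (t₀ : ℂ) :=
      ((((hasDerivAt_id (t₀ : ℂ)).mul_const Complex.I).const_mul (K : ℂ)).neg).cexp
    have := h2.mul h4
    rw [ht₀, h0, zero_mul, add_zero] at this
    exact this
  set D := P.derivative.eval z₀ * (z₀ * Complex.I) * Complex.exp (-(K * (t₀ * Complex.I)))
    with hD
  have hd : HasDerivAt (fun t : ℝ => (r t : ℂ)) D t₀ := by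
    have := hFd.comp_ofReal
    simpa only [hFr] using this
  have hre : HasDerivAt r D.re t₀ := by
    have := Complex.reCLM.hasFDerivAt.comp_hasDerivAt t₀ hd
    exact this
  have him : D.im = 0 := by
    have h1 : HasDerivAt (fun _ : ℝ => (0 : ℝ)) D.im t₀ :=
      Complex.imCLM.hasFDerivAt.comp_hasDerivAt t₀ hd
    exact h1.unique (hasDerivAt_const _ _)
  have hr0 : r t₀ = 0 := by
    have h1 := (hr t₀).2
    rw [ht₀, h0] at h1
    have hz₀' : z₀ ≠ 0 := by rw [← ht₀]; exact hz t₀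
    have := (mul_eq_zero.mp h1.symm).resolve_left (pow_ne_zero _ hz₀')
    exact_mod_cast this
  have hmin : IsLocalMin r t₀ := Filter.Eventually.of_forall fun t => by
    rw [hr0]; exact (hr t).1
  have hD0 : D = 0 := Complex.ext (hmin.hasDerivAt_eq_zero hre) him
  rw [hD] at hD0
  have hz₀' : z₀ ≠ 0 := by rw [← ht₀]; exact hz t₀
  simpa [Complex.exp_ne_zero, hz₀', Complex.I_ne_zero] using hD0

theorem infinite_unit_circle : {z : ℂ | ‖z‖ = 1}.Infinite := by
  have h : Function.Injective (fun t : Set.Ioo (0 : ℝ) 1 => Complex.exp ((t : ℝ) * Complex.I)) := by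
    intro s t hst
    have hs := s.2
    have ht := t.2
    have hpi := Real.pi_gt_three
    have := congrArg Complex.arg hst
    simp only at this
    rw [Complex.arg_exp_mul_I, Complex.arg_exp_mul_I, (toIocMod_eq_self _).mpr,
      (toIocMod_eq_self _).mpr] at this
    · exact Subtype.ext this
    · constructor <;> linarith [ht.1, ht.2]
    · constructor <;> linarith [hs.1, hs.2]
  have : (Set.range (fun t : Set.Ioo (0 : ℝ) 1 => Complex.exp ((t : ℝ) * Complex.I))).Infinite := by
    have : Infinite (Set.Ioo (0 : ℝ) 1) := (Set.Ioo_infinite zero_lt_one).to_subtype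
    exact Set.infinite_range_of_injective h
  refine this.mono ?_
  rintro _ ⟨t, rfl⟩
  exact Complex.norm_exp_ofReal_mul_I _

/-- **Fejér–Riesz**, in sum of squares form: a trigonometric polynomial `z̄^K P(z)` of degree `K`
that is nonnegative on the unit circle is a finite sum `∑ |q_i(z)|²` with `deg q_i ≤ K`. -/
theorem exists_sum_normSq_of_nonneg (K : ℕ) (P : ℂ[X]) (hdeg : P.natDegree ≤ 2 * K)
    (hpos : ∀ z : ℂ, ‖z‖ = 1 → ∃ r : ℝ, 0 ≤ r ∧ P.eval z = z ^ K * r) :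
    ∃ (m : ℕ) (q : Fin m → ℂ[X]), (∀ i, (q i).natDegree ≤ K) ∧
      ∀ z : ℂ, ‖z‖ = 1 → P.eval z = z ^ K * ∑ i, (Complex.normSq ((q i).eval z) : ℂ) := by
  induction K generalizing P with
  | zero =>
    obtain ⟨a, rfl⟩ := natDegree_eq_zero.mp (Nat.le_zero.mp hdeg)
    obtain ⟨r, hr, har⟩ := hpos 1 (by simp)
    refine ⟨1, fun _ => C (Real.sqrt r : ℂ), by simp, fun z _ => ?_⟩
    simp only [eval_C, pow_zero, one_mul] at har
    simp only [eval_C, pow_zero, one_mul, univ_unique, sum_const, card_singleton, one_smul,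
      Complex.normSq_ofReal, Real.mul_self_sqrt hr, har]
  | succ K ih =>
    have hz0 : ∀ z : ℂ, ‖z‖ = 1 → z ≠ 0 := fun z hz h => by simp [h] at hz
    have hconj : ∀ z : ℂ, ‖z‖ = 1 → conj z * z = 1 := fun z hz => by
      rw [mul_comm, Complex.mul_conj, Complex.normSq_eq_norm_sq, hz]; simp
    -- the minimum `m` of the trigonometric polynomial, attained at `z₀`
    obtain ⟨z₀, hz₀, hmin⟩ := (isCompact_sphere (0 : ℂ) 1).exists_isMinOn
      (f := fun z => (conj z ^ (K + 1) * P.eval z).re) ⟨1, by simp⟩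
      (Continuous.continuousOn (by
        have := P.continuous
        have := Complex.continuous_conj
        fun_prop))
    simp only [mem_sphere_zero_iff_norm] at hz₀
    have hval : ∀ z : ℂ, ‖z‖ = 1 → ∀ r : ℝ, P.eval z = z ^ (K + 1) * r →
        (conj z ^ (K + 1) * P.eval z).re = r := by
      intro z hz r hr
      rw [hr, ← mul_assoc, ← mul_pow, hconj z hz, one_pow, one_mul, Complex.ofReal_re]
    obtain ⟨m, hm, hPm⟩ := hpos z₀ hz₀
    set P₀ : ℂ[X] := P - C (m : ℂ) * X ^ (K + 1) with hP₀
    have hP₀pos : ∀ z : ℂ, ‖z‖ = 1 → ∃ r : ℝ, 0 ≤ r ∧ P₀.eval z = z ^ (K + 1) * r := by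
      intro z hz
      obtain ⟨r, hr, hPr⟩ := hpos z hz
      refine ⟨r - m, ?_, ?_⟩
      · have := hmin (a := z) (by simpa using hz)
        simp only [Set.mem_ofPred_eq] at this
        rw [hval z hz r hPr, hval z₀ hz₀ m hPm] at this
        linarith
      · simp only [hP₀, eval_sub, eval_mul, eval_C, eval_pow, eval_X, hPr]
        push_cast
        ring
    have hP₀z : P₀.eval z₀ = 0 := by
      simp only [hP₀, eval_sub, eval_mul, eval_C, eval_pow, eval_X, hPm]; ring
    have hP₀d := eval_derivative_eq_zero_of_nonneg hP₀pos hz₀ hP₀z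
    obtain ⟨P₁, hP₁⟩ := dvd_iff_isRoot.mpr hP₀z
    have hP₁z : P₁.eval z₀ = 0 := by
      rw [hP₁] at hP₀d
      simpa [derivative_mul] using hP₀d
    obtain ⟨P₂, hP₂⟩ := dvd_iff_isRoot.mpr hP₁z
    have hfac : P₀ = (X - C z₀) ^ 2 * P₂ := by rw [hP₁, hP₂]; ring
    -- on the circle, `(z - z₀)² = -z z₀ |z - z₀|²`
    have hsq : ∀ z : ℂ, ‖z‖ = 1 →
        (z - z₀) ^ 2 = -(z * z₀) * (Complex.normSq (z - z₀) : ℂ) := by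
      intro z hz
      rw [← Complex.mul_conj, map_sub]
      linear_combination (z - z₀) * (z₀ * hconj z hz - z * hconj z₀ hz₀)
    set P₃ : ℂ[X] := C (-z₀) * P₂ with hP₃
    have hP₀₃ : ∀ z : ℂ, ‖z‖ = 1 →
        P₀.eval z = z * (Complex.normSq (z - z₀) : ℂ) * P₃.eval z := by
      intro z hz
      rw [hfac, hP₃]
      simp only [eval_mul, eval_pow, eval_sub, eval_X, eval_C]
      rw [hsq z hz]
      ring
    have hP₃deg : P₃.natDegree ≤ 2 * K := by
      have h1 : P₀.natDegree ≤ 2 * (K + 1) := by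
        refine (natDegree_sub_le _ _).trans (max_le hdeg ?_)
        exact (natDegree_C_mul_X_pow_le _ _).trans (by omega)
      refine (natDegree_C_mul_le _ _).trans ?_
      by_cases h2 : P₂ = 0
      · simp [h2]
      · rw [hfac, natDegree_mul (pow_ne_zero _ (X_sub_C_ne_zero z₀)) h2, natDegree_pow,
          natDegree_X_sub_C] at h1
        omega
    have hne : ∀ z : ℂ, ‖z‖ = 1 → z ≠ z₀ →
        ∃ r : ℝ, 0 ≤ r ∧ P₃.eval z = z ^ K * r := by
      intro z hz hzz
      obtain ⟨r, hr, h⟩ := hP₀pos z hz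
      have hn : 0 < Complex.normSq (z - z₀) := Complex.normSq_pos.mpr (sub_ne_zero.mpr hzz)
      refine ⟨r / Complex.normSq (z - z₀), div_nonneg hr hn.le, ?_⟩
      rw [hP₀₃ z hz] at h
      have hn' : (Complex.normSq (z - z₀) : ℂ) ≠ 0 := by exact_mod_cast hn.ne'
      have := hz0 z hz
      push_cast
      field_simp
      refine mul_left_cancel₀ this ?_
      linear_combination h
    have hP₃pos : ∀ z : ℂ, ‖z‖ = 1 → ∃ r : ℝ, 0 ≤ r ∧ P₃.eval z = z ^ K * r := by
      -- the point `z₀` is reached by continuity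
      set G : ℝ → ℂ := fun t => conj (z₀ * Complex.exp (t * Complex.I)) ^ K *
        P₃.eval (z₀ * Complex.exp (t * Complex.I)) with hG
      have hGc : Continuous G := by
        have := P₃.continuous
        have := Complex.continuous_conj
        fun_prop
      have hcl : IsClosed {w : ℂ | 0 ≤ w} := isClosed_Ici
      have hev : ∀ᶠ t : ℝ in nhdsWithin 0 (Set.Ioi 0), G t ∈ {w : ℂ | 0 ≤ w} := by
        have : Set.Ioo (0 : ℝ) 1 ∈ nhdsWithin (0 : ℝ) (Set.Ioi 0) :=
          Ioo_mem_nhdsGT zero_lt_one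
        filter_upwards [this] with t ht
        have hn : ‖z₀ * Complex.exp (t * Complex.I)‖ = 1 := by
          rw [norm_mul, hz₀, Complex.norm_exp_ofReal_mul_I, one_mul]
        obtain ⟨r, hr, h⟩ := hne _ hn (by
          intro h
          have h1 : Complex.exp (t * Complex.I) = 1 :=
            mul_left_cancel₀ (hz0 z₀ hz₀) (by rw [h, mul_one])
          have h2 := congrArg Complex.im h1
          rw [Complex.exp_ofReal_mul_I_im, Complex.one_im] at h2
          exact (Real.sin_pos_of_pos_of_lt_pi ht.1 (by linarith [ht.2, Real.pi_gt_three])).ne' h2)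
        simp only [hG]
        rw [h, ← mul_assoc, ← mul_pow, hconj _ hn, one_pow, one_mul]
        exact_mod_cast hr
      have hlim : 0 ≤ G 0 := hcl.mem_of_tendsto
        (hGc.continuousAt.tendsto.mono_left nhdsWithin_le_nhds) hev
      intro z hz
      by_cases h : z = z₀
      · have hG0 : G 0 = conj z₀ ^ K * P₃.eval z₀ := by simp [hG]
        rw [hG0] at hlim
        obtain ⟨h1, h2⟩ := Complex.nonneg_iff.mp hlim
        refine ⟨(conj z₀ ^ K * P₃.eval z₀).re, h1, ?_⟩
        rw [h, show (((conj z₀ ^ K * P₃.eval z₀).re : ℝ) : ℂ) = conj z₀ ^ K * P₃.eval z₀ from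
          Complex.ext (by simp) (by simpa using h2), ← mul_assoc, ← mul_pow, mul_comm z₀,
          hconj z₀ hz₀, one_pow, one_mul]
      · exact hne z hz h
    obtain ⟨k, q, hq, hqs⟩ := ih P₃ hP₃deg hP₃pos
    refine ⟨k + 1, Fin.cons (C (Real.sqrt m : ℂ)) (fun i => (X - C z₀) * q i), ?_, ?_⟩
    · intro i
      refine Fin.cases ?_ (fun i => ?_) i
      · simp
      · simp only [Fin.cons_succ]
        refine natDegree_mul_le.trans ?_
        rw [natDegree_X_sub_C]
        have := hq i
        omega
    · intro z hz
      rw [Fin.sum_univ_succ]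
      simp only [Fin.cons_zero, Fin.cons_succ, eval_C, Complex.normSq_ofReal,
        Real.mul_self_sqrt hm, eval_mul, map_mul, eval_sub, eval_X, Complex.ofReal_mul]
      have h1 : P.eval z = P₀.eval z + m * z ^ (K + 1) := by
        simp [hP₀]
      rw [h1, hP₀₃ z hz, hqs z hz, ← mul_sum]
      ring

end TrigSIP

/-! ### Gram matrices of trigonometric polynomials -/

namespace TrigSIP
open Finset Polynomial ComplexConjugate

/-- The real trigonometric polynomial with cosine coefficients `α_0, …, α_K` and sine coefficients
`β_1, …, β_K` (the latter indexed from `0`). -/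
noncomputable def trigPoly {K : ℕ} (α : Fin (K + 1) → ℝ) (β : Fin K → ℝ) (t : ℝ) : ℝ :=
  ∑ k, α k * Real.cos ((k : ℕ) * t) + ∑ k, β k * Real.sin (((k : ℕ) + 1) * t)

theorem trunc_eq_trigPoly (f : ℝ → ℝ) (K : ℕ) (t : ℝ) :
    trunc f K t = trigPoly (cosVec f K) (sinVec f K) t := by
  have hre : ∀ k : ℤ, (coeff f (-k)).re = (coeff f k).re := fun k => by
    rw [← conj_coeff, Complex.conj_re]
  have him : ∀ k : ℤ, (coeff f (-k)).im = -(coeff f k).im := fun k => by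
    rw [← conj_coeff, Complex.conj_im]
  rw [trunc_eq_sum, trigPoly, Fin.sum_univ_succ, add_assoc, ← sum_add_distrib,
    ← Fin.sum_univ_eq_sum_range (fun k : ℕ => 2 * ((coeff f (k + 1)).re * Real.cos ((k + 1) * t)
        + (coeff f (k + 1)).im * Real.sin ((k + 1) * t)))]
  congr 1
  · simp [cosVec]
  refine sum_congr rfl fun k _ => ?_
  simp only [cosVec, sinVec, Fin.val_succ, Nat.succ_ne_zero, if_false, hre, him]
  push_cast
  ring

section Traces

variable {K : ℕ}

theorem trace_C1bar_mul (j : Fin (K + 1))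
    (Y : Matrix (Fin (K + 1) ⊕ Fin (K + 1)) (Fin (K + 1) ⊕ Fin (K + 1)) ℝ) :
    (C1bar K j * Y).trace =
      ∑ k, ∑ l, C1 K j k l * (Y (.inl l) (.inl k) + Y (.inr l) (.inr k)) := by
  simp only [Matrix.trace, Matrix.diag_apply, Matrix.mul_apply, Fintype.sum_sum_type, C1bar,
    Matrix.fromBlocks_apply₁₁, Matrix.fromBlocks_apply₁₂, Matrix.fromBlocks_apply₂₁,
    Matrix.fromBlocks_apply₂₂, Matrix.zero_apply, zero_mul, sum_const_zero, add_zero, zero_add,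
    mul_add, sum_add_distrib]

theorem trace_C2bar_mul (j : Fin K)
    (Y : Matrix (Fin (K + 1) ⊕ Fin (K + 1)) (Fin (K + 1) ⊕ Fin (K + 1)) ℝ) :
    (C2bar K j * Y).trace =
      ∑ k, ∑ l, C2 K j k l * (Y (.inl l) (.inr k) - Y (.inr l) (.inl k)) := by
  simp only [Matrix.trace, Matrix.diag_apply, Matrix.mul_apply, Fintype.sum_sum_type, C2bar,
    Matrix.fromBlocks_apply₁₁, Matrix.fromBlocks_apply₁₂, Matrix.fromBlocks_apply₂₁,
    Matrix.fromBlocks_apply₂₂, Matrix.zero_apply, zero_mul, sum_const_zero, add_zero, zero_add,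
    mul_sub, sum_sub_distrib, Matrix.neg_apply, neg_mul, sum_neg_distrib]
  ring

theorem C2_apply (j : Fin K) (k l : Fin (K + 1)) :
    C2 K j k l = (if (l : ℕ) = k + (j + 1) then 1 else 0) -
      (if (k : ℕ) = l + (j + 1) then 1 else 0) := by
  simp only [C2, Matrix.of_apply]
  split_ifs <;> first | omega | simp

theorem C1_succ_apply (j : Fin K) (k l : Fin (K + 1)) :
    C1 K j.succ k l = (if (l : ℕ) = k + (j + 1) then 1 else 0) +
      (if (k : ℕ) = l + (j + 1) then 1 else 0) := by
  have h : |((k : ℕ) : ℤ) - ((l : ℕ) : ℤ)| = ((j.succ : ℕ) : ℤ) ↔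
      (l : ℕ) = k + (j + 1) ∨ (k : ℕ) = l + (j + 1) := by
    rw [abs_eq (by positivity), Fin.val_succ]
    push_cast
    omega
  simp only [C1, Matrix.of_apply, h]
  split_ifs <;> first | omega | simp

theorem C1_zero_apply (k l : Fin (K + 1)) : C1 K 0 k l = if (k : ℕ) = l then 1 else 0 := by
  have h : |((k : ℕ) : ℤ) - ((l : ℕ) : ℤ)| = (((0 : Fin (K + 1)) : ℕ) : ℤ) ↔ (k : ℕ) = l := by
    simp only [Fin.val_zero, Nat.cast_zero, abs_eq_zero]
    omega
  simp only [C1, Matrix.of_apply, h]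

theorem sum_C1_mul_cos (k l : Fin (K + 1)) (t : ℝ) :
    ∑ j : Fin (K + 1), C1 K j k l * Real.cos ((j : ℕ) * t) =
      Real.cos (((k : ℕ) - (l : ℕ) : ℝ) * t) := by
  obtain ⟨m, hm⟩ : ∃ m : ℕ, |((k : ℕ) : ℤ) - ((l : ℕ) : ℤ)| = m :=
    Int.eq_ofNat_of_zero_le (abs_nonneg _)
  have hmK : m < K + 1 := by
    have := k.2
    have := l.2
    have := abs_sub_lt_of_nonneg_of_lt (a := ((k : ℕ) : ℤ)) (b := ((l : ℕ) : ℤ))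
      (n := (K : ℤ) + 1) (by positivity) (by omega) (by positivity) (by omega)
    omega
  have hmR : |((k : ℕ) - (l : ℕ) : ℝ)| = m := by exact_mod_cast hm
  rw [sum_eq_single (⟨m, hmK⟩ : Fin (K + 1))]
  · simp only [C1, Matrix.of_apply, hm, if_true, one_mul]
    rw [← hmR, ← Real.cos_abs (((k : ℕ) - (l : ℕ) : ℝ) * t), abs_mul,
      ← Real.cos_abs (|((k : ℕ) - (l : ℕ) : ℝ)| * t), abs_mul, abs_abs]
  · intro j _ hj
    have : ¬ ((m : ℤ) = ((j : ℕ) : ℤ)) := fun h => hj (Fin.ext (by simpa using h.symm))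
    simp only [C1, Matrix.of_apply, hm, this, if_false, zero_mul]
  · simp

theorem sum_C2_mul_sin (k l : Fin (K + 1)) (t : ℝ) :
    ∑ j : Fin K, C2 K j k l * Real.sin (((j : ℕ) + 1) * t) =
      Real.sin (((l : ℕ) - (k : ℕ) : ℝ) * t) := by
  have aux : ∀ p q : Fin (K + 1), (p : ℕ) < q →
      ∑ j : Fin K, (if (q : ℕ) = p + (j + 1) then (1 : ℝ) else 0) *
        Real.sin (((j : ℕ) + 1) * t) = Real.sin (((q : ℕ) - (p : ℕ) : ℝ) * t) := by
    intro p q hpq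
    have hq := q.2
    rw [sum_eq_single (⟨q - p - 1, by omega⟩ : Fin K)]
    · rw [if_pos (by simp only; omega), one_mul]
      congr 2
      have h : ((q : ℕ) - (p : ℕ) - 1) + 1 + (p : ℕ) = (q : ℕ) := by omega
      have h' : (((q : ℕ) - (p : ℕ) - 1 : ℕ) : ℝ) + 1 + (p : ℕ) = (q : ℕ) := by exact_mod_cast h
      simp only
      linarith
    · intro j _ hj
      rw [if_neg, zero_mul]
      intro h
      exact hj (Fin.ext (by simp only; omega))
    · simp
  have aux0 : ∀ p q : Fin (K + 1), (q : ℕ) ≤ p →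
      ∑ j : Fin K, (if (q : ℕ) = p + (j + 1) then (1 : ℝ) else 0) *
        Real.sin (((j : ℕ) + 1) * t) = 0 := by
    intro p q hpq
    refine sum_eq_zero fun j _ => ?_
    rw [if_neg (by omega), zero_mul]
  simp only [C2_apply, sub_mul, sum_sub_distrib]
  rcases lt_trichotomy (k : ℕ) (l : ℕ) with h | h | h
  · rw [aux k l h, aux0 l k h.le, sub_zero, sub_mul]
  · rw [aux0 k l h.ge, aux0 l k h.le, h]
    simp
  · rw [aux l k h, aux0 k l h.le, zero_sub, ← Real.sin_neg, ← sub_mul]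
    ring_nf

end Traces

theorem sum_weighted_comm {ι κ : Type*} [Fintype ι] [Fintype κ] (C : ι → κ → κ → ℝ)
    (w : κ → κ → ℝ) (c : ι → ℝ) :
    ∑ j, (∑ k, ∑ l, C j k l * w k l) * c j = ∑ k, ∑ l, w k l * ∑ j, C j k l * c j := by
  simp only [sum_mul, mul_sum]
  rw [sum_comm]
  refine sum_congr rfl fun k _ => ?_
  rw [sum_comm]
  refine sum_congr rfl fun l _ => sum_congr rfl fun j _ => ?_
  ring

theorem dotProduct_mulVec_sumElim {κ : Type*} [Fintype κ] (Y : Matrix (κ ⊕ κ) (κ ⊕ κ) ℝ)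
    (u v : κ → ℝ) :
    star (Sum.elim u v) ⬝ᵥ (Y.mulVec (Sum.elim u v)) =
      ∑ k, ∑ l, (Y (.inl k) (.inl l) * (u k * u l) + Y (.inl k) (.inr l) * (u k * v l) +
        Y (.inr k) (.inl l) * (v k * u l) + Y (.inr k) (.inr l) * (v k * v l)) := by
  simp only [dotProduct, Matrix.mulVec, Fintype.sum_sum_type, star_trivial, Sum.elim_inl,
    Sum.elim_inr, mul_add, mul_sum]
  rw [← sum_add_distrib]
  refine sum_congr rfl fun k _ => ?_
  simp only [← sum_add_distrib]
  refine sum_congr rfl fun l _ => ?_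
  ring

/-- A Gram matrix certifies nonnegativity: the trigonometric polynomial is the sum of the values of
the quadratic form at `(cos kt, sin kt)` and `(sin kt, -cos kt)`. -/
theorem trigPoly_nonneg_of_posSemidef {K : ℕ} {α : Fin (K + 1) → ℝ} {β : Fin K → ℝ}
    {Y : Matrix (Fin (K + 1) ⊕ Fin (K + 1)) (Fin (K + 1) ⊕ Fin (K + 1)) ℝ} (hY : Y.PosSemidef)
    (hα : applyFamily (C1bar K) Y = α) (hβ : applyFamily (C2bar K) Y = -β) (t : ℝ) :
    0 ≤ trigPoly α β t := by
  have h1 := hY.dotProduct_mulVec_nonneg (Sum.elim (fun k : Fin (K + 1) => Real.cos ((k : ℕ) * t))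
    (fun k => Real.sin ((k : ℕ) * t)))
  have h2 := hY.dotProduct_mulVec_nonneg (Sum.elim (fun k : Fin (K + 1) => Real.sin ((k : ℕ) * t))
    (fun k => -Real.cos ((k : ℕ) * t)))
  refine (add_nonneg h1 h2).trans_eq ?_
  have ec : ∑ j, α j * Real.cos ((j : ℕ) * t) =
      ∑ k, ∑ l, (Y (.inl k) (.inl l) + Y (.inr k) (.inr l)) *
        Real.cos (((l : ℕ) - (k : ℕ) : ℝ) * t) := by
    simp only [← hα, applyFamily, trace_C1bar_mul]
    rw [sum_weighted_comm (C1 K), sum_comm]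
    simp only [sum_C1_mul_cos]
  have es : ∑ j, β j * Real.sin (((j : ℕ) + 1) * t) =
      ∑ k, ∑ l, (Y (.inr k) (.inl l) - Y (.inl k) (.inr l)) *
        Real.sin (((k : ℕ) - (l : ℕ) : ℝ) * t) := by
    have hβ' : ∀ j, β j = -applyFamily (C2bar K) Y j := fun j => by rw [hβ]; simp
    simp only [hβ', applyFamily, trace_C2bar_mul, neg_mul, sum_neg_distrib]
    rw [sum_weighted_comm (C2 K), sum_comm]
    simp only [sum_C2_mul_sin, ← sum_neg_distrib]
    refine sum_congr rfl fun k _ => sum_congr rfl fun l _ => ?_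
    ring
  rw [trigPoly, ec, es, dotProduct_mulVec_sumElim, dotProduct_mulVec_sumElim]
  simp only [← sum_add_distrib]
  refine sum_congr rfl fun k _ => sum_congr rfl fun l _ => ?_
  rw [sub_mul ((l : ℕ) : ℝ), sub_mul ((k : ℕ) : ℝ), Real.cos_sub, Real.sin_sub]
  ring

section Gram

variable {K : ℕ}

/-- The real rank-one matrix `y yᵀ` with `y = (Re b, Im b)`. -/
noncomputable def realGram (b : Fin (K + 1) → ℂ) :
    Matrix (Fin (K + 1) ⊕ Fin (K + 1)) (Fin (K + 1) ⊕ Fin (K + 1)) ℝ :=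
  Matrix.vecMulVec (Sum.elim (fun k => (b k).re) (fun k => (b k).im))
    (star (Sum.elim (fun k => (b k).re) (fun k => (b k).im)))

/-- The coefficient of `z^j` in `|∑ k, b k z^k|²` on the unit circle. -/
noncomputable def autocorr (b : Fin (K + 1) → ℂ) (j : ℕ) : ℂ :=
  ∑ k : Fin (K + 1), ∑ l : Fin (K + 1), if (k : ℕ) = l + j then b k * conj (b l) else 0

theorem trace_C1bar_zero_mul_realGram (b : Fin (K + 1) → ℂ) :
    (C1bar K 0 * realGram b).trace = (autocorr b 0).re := by
  simp only [trace_C1bar_mul, C1_zero_apply, autocorr, Complex.re_sum, realGram,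
    Matrix.vecMulVec_apply, Sum.elim_inl, Sum.elim_inr, star_trivial, add_zero]
  refine sum_congr rfl fun k _ => sum_congr rfl fun l _ => ?_
  split_ifs <;> simp
  ring

theorem trace_C1bar_succ_mul_realGram (b : Fin (K + 1) → ℂ) (j : Fin K) :
    (C1bar K j.succ * realGram b).trace = 2 * (autocorr b (j + 1)).re := by
  simp only [trace_C1bar_mul, C1_succ_apply, autocorr, Complex.re_sum, realGram,
    Matrix.vecMulVec_apply, Sum.elim_inl, Sum.elim_inr, star_trivial, add_mul, sum_add_distrib]
  rw [sum_comm, two_mul]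
  congr 1 <;>
  · refine sum_congr rfl fun k _ => sum_congr rfl fun l _ => ?_
    split_ifs <;> simp
    try ring

theorem trace_C2bar_mul_realGram (b : Fin (K + 1) → ℂ) (j : Fin K) :
    (C2bar K j * realGram b).trace = -(2 * (autocorr b (j + 1)).im) := by
  simp only [trace_C2bar_mul, C2_apply, autocorr, Complex.im_sum, realGram,
    Matrix.vecMulVec_apply, Sum.elim_inl, Sum.elim_inr, star_trivial, sub_mul, sum_sub_distrib]
  rw [sum_comm, two_mul, neg_add, sub_eq_add_neg, ← sum_neg_distrib]
  congr 1 <;>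
  · simp only [← sum_neg_distrib]
    refine sum_congr rfl fun k _ => sum_congr rfl fun l _ => ?_
    split_ifs <;> simp
    try ring

theorem normSq_eval_mul_pow {q : ℂ[X]} (hq : q.natDegree ≤ K) {z : ℂ} (hz : ‖z‖ = 1) :
    z ^ K * (Complex.normSq (q.eval z) : ℂ) =
      ∑ k : Fin (K + 1), ∑ l : Fin (K + 1),
        q.coeff k * conj (q.coeff l) * z ^ (K + k - l : ℕ) := by
  have he : q.eval z = ∑ k : Fin (K + 1), q.coeff k * z ^ (k : ℕ) := by
    rw [eval_eq_sum_range' (Nat.lt_succ_of_le hq), Finset.sum_range]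
  have hzc : z * conj z = 1 := by
    rw [Complex.mul_conj, Complex.normSq_eq_norm_sq, hz]; simp
  rw [← Complex.mul_conj]
  nth_rewrite 2 [he]
  rw [he, map_sum, sum_mul_sum, mul_sum]
  refine sum_congr rfl fun k _ => ?_
  rw [mul_sum]
  refine sum_congr rfl fun l _ => ?_
  have hl := l.2
  have h1 : z ^ (K + k - l : ℕ) = z ^ (K + k : ℕ) * conj z ^ (l : ℕ) := by
    rw [show (K + k : ℕ) = (K + k - l) + l by omega, pow_add, mul_assoc, ← mul_pow, hzc, one_pow,
      mul_one]
    congr 1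
    omega
  rw [h1, map_mul, map_pow, pow_add]
  ring

/-- The polynomial `z^K p(t)`, `z = e^{-it}`, attached to a trigonometric polynomial `p`. -/
noncomputable def laurentPoly (α : Fin (K + 1) → ℝ) (β : Fin K → ℝ) : ℂ[X] :=
  C (α 0 : ℂ) * X ^ K + ∑ k : Fin K,
    (C ((α k.succ + β k * Complex.I) / 2) * X ^ (K + (k + 1) : ℕ) +
      C ((α k.succ - β k * Complex.I) / 2) * X ^ (K - (k + 1) : ℕ))

theorem natDegree_laurentPoly_le (α : Fin (K + 1) → ℝ) (β : Fin K → ℝ) :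
    (laurentPoly α β).natDegree ≤ 2 * K := by
  refine natDegree_add_le_of_degree_le ((natDegree_C_mul_X_pow_le _ _).trans (by omega)) ?_
  refine natDegree_sum_le_of_forall_le _ _ fun k _ => ?_
  have := k.2
  exact natDegree_add_le_of_degree_le ((natDegree_C_mul_X_pow_le _ _).trans (by omega))
    ((natDegree_C_mul_X_pow_le _ _).trans (by omega))

theorem coeff_laurentPoly_zero (α : Fin (K + 1) → ℝ) (β : Fin K → ℝ) :
    (laurentPoly α β).coeff K = α 0 := by
  simp only [laurentPoly, coeff_add, finsetSum_coeff, coeff_C_mul, coeff_X_pow]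
  rw [sum_eq_zero]
  · simp
  · intro k _
    have := k.2
    rw [if_neg (by omega), if_neg (by omega)]
    simp

theorem coeff_laurentPoly_succ (α : Fin (K + 1) → ℝ) (β : Fin K → ℝ) (j : Fin K) :
    (laurentPoly α β).coeff (K + (j + 1)) = (α j.succ + β j * Complex.I) / 2 := by
  simp only [laurentPoly, coeff_add, finsetSum_coeff, coeff_C_mul, coeff_X_pow]
  rw [sum_eq_single j]
  · rw [if_neg (by omega), if_pos rfl, if_neg (by omega)]
    simp
  · intro k _ hk
    have : (j : ℕ) ≠ k := fun h => hk (Fin.ext h.symm)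
    rw [if_neg (by omega), if_neg (by omega)]
    simp
  · simp

theorem eval_laurentPoly (α : Fin (K + 1) → ℝ) (β : Fin K → ℝ) (t : ℝ) :
    (laurentPoly α β).eval (Complex.exp (-(t * Complex.I))) =
      Complex.exp (-(t * Complex.I)) ^ K * trigPoly α β t := by
  set z := Complex.exp (-(t * Complex.I)) with hz
  set w := Complex.exp (t * Complex.I) with hw
  have hwz : z * w = 1 := by rw [hz, hw, ← Complex.exp_add]; simp
  rw [trigPoly, Fin.sum_univ_succ]
  simp only [laurentPoly, eval_add, eval_mul, eval_C, eval_pow, eval_X, eval_finsetSum]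
  push_cast
  rw [add_assoc, ← sum_add_distrib, mul_add, mul_sum]
  congr 1
  · simp; ring
  refine sum_congr rfl fun k _ => ?_
  have hk := k.2
  have e1 : Complex.exp ((((k : ℕ) + 1 : ℂ) * t) * Complex.I) = w ^ ((k : ℕ) + 1) := by
    rw [hw, ← Complex.exp_nat_mul]; push_cast; ring_nf
  have e2 : Complex.exp (-((((k : ℕ) + 1 : ℂ) * t)) * Complex.I) = z ^ ((k : ℕ) + 1) := by
    rw [hz, ← Complex.exp_nat_mul]; push_cast; ring_nf
  have e3 : z ^ (K - (k + 1) : ℕ) = z ^ K * w ^ ((k : ℕ) + 1) := by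
    have : z ^ K = z ^ (K - (k + 1) : ℕ) * z ^ ((k : ℕ) + 1) := by
      rw [← pow_add, Nat.sub_add_cancel hk]
    rw [this, mul_assoc, ← mul_pow, hwz, one_pow, mul_one]
  simp only [Fin.val_succ]
  push_cast
  rw [Complex.cos, Complex.sin, e1, e2, e3, pow_add]
  ring

/-- A nonnegative trigonometric polynomial has a Gram matrix, by Fejér–Riesz. -/
theorem exists_posSemidef_of_trigPoly_nonneg {α : Fin (K + 1) → ℝ} {β : Fin K → ℝ}
    (h : ∀ t ∈ Set.Icc (0 : ℝ) (2 * Real.pi), 0 ≤ trigPoly α β t) :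
    ∃ Y : Matrix (Fin (K + 1) ⊕ Fin (K + 1)) (Fin (K + 1) ⊕ Fin (K + 1)) ℝ, Y.PosSemidef ∧
      applyFamily (C1bar K) Y = α ∧ applyFamily (C2bar K) Y = -β := by
  have hpos : ∀ z : ℂ, ‖z‖ = 1 → ∃ r : ℝ, 0 ≤ r ∧ (laurentPoly α β).eval z = z ^ K * r := by
    intro z hz
    obtain ⟨t, ht, rfl⟩ : ∃ t ∈ Set.Icc (0 : ℝ) (2 * Real.pi),
        Complex.exp (-(t * Complex.I)) = z := by
      have hz' : Complex.exp (z.arg * Complex.I) = z := by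
        simpa [hz] using Complex.norm_mul_exp_arg_mul_I z
      have h1 := Complex.neg_pi_lt_arg z
      have h2 := Complex.arg_le_pi z
      rcases le_total z.arg 0 with h0 | h0
      · refine ⟨-z.arg, ⟨by linarith, by linarith⟩, Eq.trans ?_ hz'⟩
        push_cast
        simp
      · refine ⟨2 * Real.pi - z.arg, ⟨by linarith, by linarith⟩, Eq.trans ?_ hz'⟩
        push_cast
        rw [show -((2 * (Real.pi : ℂ) - z.arg) * Complex.I) =
          z.arg * Complex.I - 2 * Real.pi * Complex.I by ring, Complex.exp_sub,
          Complex.exp_two_pi_mul_I, div_one]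
    exact ⟨_, h t ht, eval_laurentPoly α β t⟩
  obtain ⟨m, q, hq, hP⟩ :=
    exists_sum_normSq_of_nonneg K _ (natDegree_laurentPoly_le α β) hpos
  have hpoly : laurentPoly α β = ∑ i, ∑ k : Fin (K + 1), ∑ l : Fin (K + 1),
      C ((q i).coeff k * conj ((q i).coeff l)) * X ^ (K + k - l : ℕ) := by
    refine eq_of_infinite_eval_eq _ _ (infinite_unit_circle.mono fun z hz => ?_)
    have hz : ‖z‖ = 1 := hz
    change (laurentPoly α β).eval z = _
    rw [hP z hz, mul_sum]
    simp only [eval_finsetSum, eval_mul, eval_C, eval_pow, eval_X]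
    exact sum_congr rfl fun i _ => normSq_eval_mul_pow (hq i) hz
  have hcoeff : ∀ j : ℕ, (laurentPoly α β).coeff (K + j) =
      ∑ i, autocorr (fun k : Fin (K + 1) => (q i).coeff k) j := by
    intro j
    rw [hpoly]
    simp only [finsetSum_coeff, coeff_C_mul, coeff_X_pow, autocorr]
    refine sum_congr rfl fun i _ => sum_congr rfl fun k _ => sum_congr rfl fun l _ => ?_
    have hl := l.2
    have : K + j = K + (k : ℕ) - l ↔ (k : ℕ) = l + j := by omega
    simp only [this, mul_ite, mul_one, mul_zero]
  refine ⟨∑ i, realGram fun k => (q i).coeff k,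
    Matrix.posSemidef_sum _ fun i _ => Matrix.posSemidef_vecMulVec_self_star _, ?_, ?_⟩
  · funext j
    simp only [applyFamily, mul_sum, Matrix.trace_sum]
    refine Fin.cases ?_ (fun j => ?_) j
    · simp only [trace_C1bar_zero_mul_realGram]
      rw [← Complex.re_sum, ← hcoeff 0, add_zero, coeff_laurentPoly_zero, Complex.ofReal_re]
    · simp only [trace_C1bar_succ_mul_realGram]
      rw [← mul_sum, ← Complex.re_sum, ← hcoeff, coeff_laurentPoly_succ]
      simp
      ring
  · funext j
    simp only [applyFamily, mul_sum, Matrix.trace_sum, trace_C2bar_mul_realGram]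
    rw [sum_neg_distrib, ← mul_sum, ← Complex.im_sum, ← hcoeff, coeff_laurentPoly_succ]
    simp
    ring

end Gram

/-- The feasible set of the truncated program is the projection of the feasible set of the
semidefinite program. -/
theorem mem_feasFP_iff {n : ℕ} (a : Fin (n + 1) → ℝ → ℝ) (K : ℕ)
    (x : EuclideanSpace ℝ (Fin n)) : x ∈ feasFP a K ↔ ∃ Y, (x, Y) ∈ feasTFP a K := by
  set α : Fin (K + 1) → ℝ := pVec a K - Matrix.mulVec (EMat a K).transpose x.ofLp with hα
  set β : Fin K → ℝ := qVec a K - Matrix.mulVec (FMat a K).transpose x.ofLp with hβ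
  have hslack : ∀ t, trunc (a 0) K t - ∑ j, trunc (a (Fin.succ j)) K t * x j = trigPoly α β t := by
    intro t
    simp only [trunc_eq_trigPoly, trigPoly, hα, hβ, Pi.sub_apply, sub_mul, sum_sub_distrib,
      Matrix.mulVec, dotProduct, Matrix.transpose_apply, EMat, FMat, pVec, qVec, Matrix.of_apply,
      sum_mul, add_mul, sum_add_distrib]
    rw [sum_comm (f := fun (j : Fin n) (k : Fin (K + 1)) => _),
      sum_comm (f := fun (j : Fin n) (k : Fin K) => _)]
    simp only [mul_right_comm _ (Real.cos _), mul_right_comm _ (Real.sin _)]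
    ring
  have hfp : x ∈ feasFP a K ↔ ∀ t ∈ Set.Icc (0 : ℝ) (2 * Real.pi), 0 ≤ trigPoly α β t := by
    refine forall₂_congr fun t _ => ?_
    rw [← hslack, sub_nonneg]
  have htfp : ∀ Y, (x, Y) ∈ feasTFP a K ↔
      Y.PosSemidef ∧ applyFamily (C1bar K) Y = α ∧ applyFamily (C2bar K) Y = -β := by
    intro Y
    have h1 : applyFamily (C1bar K) Y + Matrix.mulVec (EMat a K).transpose x.ofLp - pVec a K = 0 ↔
        applyFamily (C1bar K) Y = α := by
      rw [hα, sub_eq_zero, eq_sub_iff_add_eq]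
    have h2 : applyFamily (C2bar K) Y - Matrix.mulVec (FMat a K).transpose x.ofLp + qVec a K = 0 ↔
        applyFamily (C2bar K) Y = -β := by
      rw [hβ, neg_sub, sub_add, sub_eq_zero]
    change _ ∧ _ ∧ _ ↔ _
    rw [h1, h2]
    tauto
  rw [hfp]
  constructor
  · intro h
    obtain ⟨Y, hY⟩ := exists_posSemidef_of_trigPoly_nonneg h
    exact ⟨Y, (htfp Y).mpr hY⟩
  · rintro ⟨Y, hY⟩ t _
    obtain ⟨h1, h2, h3⟩ := (htfp Y).mp hY
    exact trigPoly_nonneg_of_posSemidef h1 h2 h3 t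

end TrigSIP

/-! ### Stability of the semi-infinite program -/

namespace TrigSIP
open Finset

section Stability

variable {n : ℕ}

theorem sum_mul_add_smul (b : Fin n → ℝ) (x y : EuclideanSpace ℝ (Fin n)) (s : ℝ) :
    ∑ j, b j * (x + s • y) j = ∑ j, b j * x j + s * ∑ j, b j * y j := by
  rw [mul_sum, ← sum_add_distrib]
  refine sum_congr rfl fun j _ => ?_
  simp only [PiLp.add_apply, PiLp.smul_apply, smul_eq_mul]
  ring

theorem objective_add_smul (c x y : EuclideanSpace ℝ (Fin n)) (s : ℝ) :
    objective c (x + s • y) = objective c x + s * objective c y :=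
  sum_mul_add_smul c x y s

theorem optimalValue_eq_of_mem_solutionSet {c x : EuclideanSpace ℝ (Fin n)}
    {F : Set (EuclideanSpace ℝ (Fin n))} (hx : x ∈ solutionSet c F) :
    optimalValue c F = objective c x := by
  refine IsLeast.csInf_eq ⟨⟨x, hx.1, rfl⟩, ?_⟩
  rintro _ ⟨y, hy, rfl⟩
  exact hx.2 y hy

/-- A direction that is feasible at infinity and does not increase the objective is a recession
direction of the solution set, so a bounded solution set makes the constraints and the objective
jointly coercive. -/
theorem exists_coercive {b : Fin n → ℝ → ℝ} {b₀ : ℝ → ℝ} {c : EuclideanSpace ℝ (Fin n)} {R : ℝ}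
    (hne : (solutionSet c (feasibleSet b b₀)).Nonempty)
    (hR : ∀ x ∈ solutionSet c (feasibleSet b b₀), ‖x‖ ≤ R) :
    ∃ μ : ℝ, 0 < μ ∧ ∀ d : EuclideanSpace ℝ (Fin n), μ * ‖d‖ ≤ objective c d ∨
      ∃ t ∈ Set.Icc (0 : ℝ) (2 * Real.pi), μ * ‖d‖ ≤ ∑ j, b j t * d j := by
  by_contra! hcon
  have hlin : ∀ (w : Fin n → ℝ) (s : ℝ) (d : EuclideanSpace ℝ (Fin n)),
      ∑ j, w j * (s • d) j = s * ∑ j, w j * d j := by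
    intro w s d
    simpa using sum_mul_add_smul w 0 d s
  have hstep : ∀ k : ℕ, ∃ u : EuclideanSpace ℝ (Fin n), ‖u‖ = 1 ∧
      objective c u ≤ 1 / ((k : ℝ) + 1) ∧
      ∀ t ∈ Set.Icc (0 : ℝ) (2 * Real.pi), ∑ j, b j t * u j ≤ 1 / ((k : ℝ) + 1) := by
    intro k
    obtain ⟨d, hd, hdt⟩ := hcon (1 / ((k : ℝ) + 1)) (by positivity)
    have hd0 : d ≠ 0 := by
      rintro rfl
      simp [objective] at hd
    have hn : 0 < ‖d‖ := norm_pos_iff.mpr hd0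
    refine ⟨‖d‖⁻¹ • d, by rw [norm_smul, norm_inv, norm_norm, inv_mul_cancel₀ hn.ne'], ?_, ?_⟩
    · rw [objective, hlin, inv_mul_le_iff₀ hn, mul_comm]
      exact hd.le
    · intro t ht
      rw [hlin, inv_mul_le_iff₀ hn, mul_comm]
      exact (hdt t ht).le
  choose u hu1 huc hut using hstep
  obtain ⟨d, hd, φ, hφ, hlim⟩ := (isCompact_sphere (0 : EuclideanSpace ℝ (Fin n)) 1).tendsto_subseq
    (x := u) (fun k => by simpa using hu1 k)
  have hd1 : ‖d‖ = 1 := by simpa using hd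
  have hlim0 : Filter.Tendsto (fun k => 1 / ((φ k : ℝ) + 1)) Filter.atTop (nhds 0) :=
    (tendsto_one_div_add_atTop_nhds_zero_nat (𝕜 := ℝ)).comp hφ.tendsto_atTop
  have hcts : ∀ w : Fin n → ℝ,
      Continuous fun x : EuclideanSpace ℝ (Fin n) => ∑ j, w j * x j := fun w => by fun_prop
  have hdc : objective c d ≤ 0 :=
    le_of_tendsto_of_tendsto' (((hcts c).tendsto d).comp hlim) hlim0 fun k => huc (φ k)
  have hdt : ∀ t ∈ Set.Icc (0 : ℝ) (2 * Real.pi), ∑ j, b j t * d j ≤ 0 := fun t ht =>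
    le_of_tendsto_of_tendsto' (((hcts fun j => b j t).tendsto d).comp hlim) hlim0
      fun k => hut (φ k) t ht
  obtain ⟨x, hx⟩ := hne
  have hxR := hR x hx
  have hs : 0 ≤ ‖x‖ + R + 1 := by linarith [norm_nonneg x]
  have hmem : x + (‖x‖ + R + 1) • d ∈ solutionSet c (feasibleSet b b₀) := by
    refine ⟨fun t ht => ?_, fun y hy => ?_⟩
    · rw [sum_mul_add_smul]
      have := mul_nonpos_of_nonneg_of_nonpos hs (hdt t ht)
      linarith [hx.1 t ht]
    · rw [objective_add_smul]
      have := mul_nonpos_of_nonneg_of_nonpos hs hdc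
      linarith [hx.2 y hy]
  have h1 := hR _ hmem
  have h2 := norm_sub_norm_le ((‖x‖ + R + 1) • d) (-x)
  rw [sub_neg_eq_add, norm_neg, norm_smul, hd1, mul_one, Real.norm_of_nonneg hs, add_comm _ x] at h2
  linarith

variable {a : Fin (n + 1) → ℝ → ℝ} {A : ℝ}

theorem abs_sum_sub_sum_trunc_le (hA : IsTruncErrorConst a A) {K : ℕ} (hK : 2 ≤ K) {t : ℝ}
    (ht : t ∈ Set.Icc (0 : ℝ) (2 * Real.pi)) (x : EuclideanSpace ℝ (Fin n)) :
    |∑ j, a (Fin.succ j) t * x j - ∑ j, trunc (a (Fin.succ j)) K t * x j| ≤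
      A * (Real.log K / K) * (n * ‖x‖) := by
  rw [← sum_sub_distrib]
  refine (abs_sum_le_sum_abs _ _).trans ?_
  have : ∀ j ∈ univ, |a (Fin.succ j) t * x j - trunc (a (Fin.succ j)) K t * x j| ≤
      A * (Real.log K / K) * ‖x‖ := by
    intro j _
    rw [← sub_mul, abs_mul]
    have h := hA.2 K hK j.succ t ht
    exact mul_le_mul h (PiLp.norm_apply_le x j) (abs_nonneg _) ((abs_nonneg _).trans h)
  refine (sum_le_sum this).trans_eq ?_
  rw [sum_const, card_univ, Fintype.card_fin, nsmul_eq_mul]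
  ring

theorem tendsto_log_div_natCast :
    Filter.Tendsto (fun K : ℕ => Real.log K / K) Filter.atTop (nhds 0) :=
  (Real.isLittleO_log_id_atTop.tendsto_div_nhds_zero).comp tendsto_natCast_atTop_atTop

theorem eventually_mul_log_div_natCast_le (C : ℝ) {δ : ℝ} (hδ : 0 < δ) :
    ∀ᶠ K : ℕ in Filter.atTop, C * (Real.log K / K) ≤ δ := by
  have := tendsto_log_div_natCast.const_mul C
  rw [mul_zero] at this
  exact (this.eventually (gt_mem_nhds hδ)).mono fun _ h => h.le

theorem log_div_natCast_pos {K : ℕ} (hK : 2 ≤ K) : 0 < Real.log K / K := by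
  have : (2 : ℝ) ≤ K := by exact_mod_cast hK
  exact div_pos (Real.log_pos (by linarith)) (by linarith)

/-- Points that satisfy the truncated constraints and have the optimal value, both up to
`O(ln K / K)`, lie in a fixed ball; there the original constraints are violated by `O(ln K / K)`,
and a step of that length along `x'` restores feasibility. -/
theorem exists_isEpsOptimal_of_almost_feasible {c : EuclideanSpace ℝ (Fin n)} {R : ℝ}
    (h₀ : ContinuousOn (a 0) (Set.Icc (0 : ℝ) (2 * Real.pi)))
    {x' : EuclideanSpace ℝ (Fin n)} {Q : ℝ} (hQ : Q < 0)
    (hx' : ∀ t ∈ Set.Icc (0 : ℝ) (2 * Real.pi), ∑ j, a (Fin.succ j) t * x' j ≤ Q)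
    (hne : (solutionSet c (feasP a)).Nonempty)
    (hR : ∀ x ∈ solutionSet c (feasP a), ‖x‖ ≤ R)
    (hA : IsTruncErrorConst a A) {D : ℝ} (hD : 0 ≤ D) :
    ∃ L : ℝ, 0 < L ∧ ∀ᶠ K : ℕ in Filter.atTop, ∀ x : EuclideanSpace ℝ (Fin n),
      objective c x ≤ optimalValue c (feasP a) + D * (Real.log K / K) →
      (∀ t ∈ Set.Icc (0 : ℝ) (2 * Real.pi), ∑ j, trunc (a (Fin.succ j)) K t * x j ≤
        trunc (a 0) K t + D * (Real.log K / K)) →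
      IsEpsOptimal c (feasP a) L (Real.log K / K) x := by
  obtain ⟨μ, hμ, hco⟩ := exists_coercive hne hR
  obtain ⟨x₀, hx₀⟩ := hne
  obtain ⟨B₀, hB₀⟩ := isCompact_Icc.exists_bound_of_continuousOn h₀
  set v := optimalValue c (feasP a) with hv
  have hvx : v = objective c x₀ := optimalValue_eq_of_mem_solutionSet hx₀
  have hA0 := hA.1
  have hB₀0 : 0 ≤ B₀ := (norm_nonneg _).trans (hB₀ 0 ⟨le_rfl, by positivity⟩)
  set B : ℝ := 2 * (|v| + D + B₀ + A) / μ with hB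
  have hB0 : 0 ≤ B := by positivity
  set E : ℝ := A + D + A * (n * B) with hE
  have hE0 : 0 ≤ E := by positivity
  have hQ' : 0 < -Q := neg_pos.mpr hQ
  refine ⟨D + E / (-Q) * (‖x'‖ + |objective c x'|) + 1, by positivity, ?_⟩
  filter_upwards [Filter.eventually_ge_atTop 2, eventually_mul_log_div_natCast_le 1 one_pos,
    eventually_mul_log_div_natCast_le (A * n) (half_pos hμ)] with K hK hε1 hεμ x hxv hxt
  set ε := Real.log K / K with hε
  have hε0 : 0 < ε := log_div_natCast_pos hK
  rw [one_mul] at hε1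
  have hDε : D * ε ≤ D := mul_le_of_le_one_right hD hε1
  have hAε : A * ε ≤ A := mul_le_of_le_one_right hA0.le hε1
  have hxa : ∀ t ∈ Set.Icc (0 : ℝ) (2 * Real.pi), ∑ j, a (Fin.succ j) t * x j ≤
      a 0 t + (A + D) * ε + A * ε * (n * ‖x‖) := by
    intro t ht
    have h1 := abs_le.mp (abs_sum_sub_sum_trunc_le hA hK ht x)
    have h2 := abs_le.mp (hA.2 K hK 0 t ht)
    linarith [hxt t ht, h1.2, h2.1]
  have hnorm : ‖x‖ ≤ B := by
    rw [hB, le_div_iff₀ hμ]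
    have hv' := le_abs_self v
    have hμx : 0 ≤ μ * ‖x‖ := by positivity
    rcases hco x with h | ⟨t, ht, h⟩
    · have := abs_nonneg v
      nlinarith
    · have h1 := hxa t ht
      have h2 : A * ε * (n * ‖x‖) ≤ μ / 2 * ‖x‖ := by
        calc A * ε * (n * ‖x‖) = A * n * ε * ‖x‖ := by ring
          _ ≤ _ := mul_le_mul_of_nonneg_right hεμ (norm_nonneg x)
      have h3 := (abs_le.mp (hB₀ t ht)).2
      have := abs_nonneg v
      nlinarith
  have hxE : ∀ t ∈ Set.Icc (0 : ℝ) (2 * Real.pi), ∑ j, a (Fin.succ j) t * x j ≤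
      a 0 t + E * ε := by
    intro t ht
    have h1 : A * ε * (n * ‖x‖) ≤ A * ε * (n * B) := by gcongr
    have := hxa t ht
    rw [hE]
    linarith
  set s : ℝ := E / (-Q) * ε with hs
  have hs0 : 0 ≤ s := by positivity
  have hsQ : s * Q = -(E * ε) := by
    have := hQ.ne
    rw [hs]
    field_simp
  have hy : x + s • x' ∈ feasP a := by
    intro t ht
    rw [sum_mul_add_smul]
    have := mul_le_mul_of_nonneg_left (hx' t ht) hs0
    linarith [hxE t ht]
  have e1 : (D + E / (-Q) * (‖x'‖ + |objective c x'|) + 1) * ε =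
      D * ε + s * ‖x'‖ + s * |objective c x'| + ε := by rw [hs]; ring
  have p1 : 0 ≤ s * ‖x'‖ := by positivity
  have p2 : 0 ≤ s * |objective c x'| := by positivity
  have p3 : 0 ≤ D * ε := by positivity
  constructor
  · rw [e1, abs_le]
    have h1 := hx₀.2 _ hy
    rw [objective_add_smul, ← hvx] at h1
    have h2 := mul_le_mul_of_nonneg_left (le_abs_self (objective c x')) hs0
    constructor <;> linarith
  · rw [e1]
    refine (Metric.infDist_le_dist_of_mem hy).trans ?_
    rw [dist_eq_norm, sub_add_cancel_left, norm_neg, norm_smul, Real.norm_of_nonneg hs0]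
    linarith

/-- An optimal solution moved by `O(ln K / K)` along `x'` is a Slater point of the truncated
program. -/
theorem exists_slater_point_near_optimal {c : EuclideanSpace ℝ (Fin n)}
    {x' : EuclideanSpace ℝ (Fin n)} {Q : ℝ} (hQ : Q < 0)
    (hx' : ∀ t ∈ Set.Icc (0 : ℝ) (2 * Real.pi), ∑ j, a (Fin.succ j) t * x' j ≤ Q)
    (hne : (solutionSet c (feasP a)).Nonempty) (hA : IsTruncErrorConst a A) :
    ∃ D : ℝ, 0 ≤ D ∧ ∀ᶠ K : ℕ in Filter.atTop, ∃ y : EuclideanSpace ℝ (Fin n),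
      (∀ t ∈ Set.Icc (0 : ℝ) (2 * Real.pi),
        ∑ j, trunc (a (Fin.succ j)) K t * y j < trunc (a 0) K t) ∧
      objective c y ≤ optimalValue c (feasP a) + D * (Real.log K / K) := by
  obtain ⟨x₀, hx₀⟩ := hne
  have hvx := optimalValue_eq_of_mem_solutionSet hx₀
  have hA0 := hA.1
  have hQ' : 0 < -Q := neg_pos.mpr hQ
  -- with step `s = σ ln K / K`, half of the gain `-s Q` pays for the truncation error along `x'`,
  -- a quarter for those at `x₀` and of the right-hand side; the last quarter makes it strict
  set σ : ℝ := 4 * (A * (1 + n * ‖x₀‖)) / (-Q) with hσ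
  have hσ0 : 0 < σ := by positivity
  refine ⟨σ * |objective c x'|, by positivity, ?_⟩
  filter_upwards [Filter.eventually_ge_atTop 2,
    eventually_mul_log_div_natCast_le (A * (n * ‖x'‖)) (half_pos hQ')] with K hK hεQ
  set ε := Real.log K / K with hε
  have hε0 : 0 < ε := log_div_natCast_pos hK
  refine ⟨x₀ + (σ * ε) • x', fun t ht => ?_, ?_⟩
  · have h1 := abs_le.mp (abs_sum_sub_sum_trunc_le hA hK ht (x₀ + (σ * ε) • x'))
    have h2 := abs_le.mp (hA.2 K hK 0 t ht)
    have h3 : ‖x₀ + (σ * ε) • x'‖ ≤ ‖x₀‖ + σ * ε * ‖x'‖ := by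
      refine (norm_add_le _ _).trans_eq ?_
      rw [norm_smul, Real.norm_of_nonneg (by positivity)]
    have h4 : A * ε * (n * ‖x₀ + (σ * ε) • x'‖) ≤ A * ε * (n * (‖x₀‖ + σ * ε * ‖x'‖)) := by
      gcongr
    have h5 : σ * ε * (A * (n * ‖x'‖) * ε) ≤ σ * ε * (-Q / 2) :=
      mul_le_mul_of_nonneg_left hεQ (by positivity)
    have h6 : σ * ε * Q = -(4 * (A * (1 + n * ‖x₀‖)) * ε) := by
      have := hQ.ne
      rw [hσ]
      field_simp
    have h7 : σ * ε * ∑ j, a (Fin.succ j) t * x' j ≤ σ * ε * Q :=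
      mul_le_mul_of_nonneg_left (hx' t ht) (by positivity)
    have h8 : 0 < A * (1 + n * ‖x₀‖) * ε := by positivity
    have h9 := hx₀.1 t ht
    rw [sum_mul_add_smul (fun j => a (Fin.succ j) t)] at h1
    simp only at h9
    nlinarith [h1.1, h2.1]
  · rw [objective_add_smul, hvx]
    have := mul_le_mul_of_nonneg_left (le_abs_self (objective c x'))
      (show 0 ≤ σ * ε by positivity)
    linarith

theorem mem_feasAFP_of_norm_le {R : ℝ} (hA : IsTruncErrorConst a A) {K : ℕ} (hK : 2 ≤ K)
    {x : EuclideanSpace ℝ (Fin n)} (hx : x ∈ feasP a) (hxR : ‖x‖ ≤ R) : x ∈ feasAFP a R A K := by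
  intro t ht
  have h1 := abs_le.mp (abs_sum_sub_sum_trunc_le hA hK ht x)
  have h2 := abs_le.mp (hA.2 K hK 0 t ht)
  have h3 := hx t ht
  have hε0 := log_div_natCast_pos hK
  have hA0 := hA.1
  have hR0 := (norm_nonneg x).trans hxR
  have h4 : A * (Real.log K / K) * (n * ‖x‖) ≤ A * (Real.log K / K) * (n * R) := by gcongr
  have h5 : 0 ≤ A * (Real.log K / K) * (n * R + 1) := by positivity
  simp only at h3 ⊢
  nlinarith [h1.1, h2.2]

end Stability

end TrigSIP

theorem theorem1 (n : ℕ) (a : Fin (n + 1) → ℝ → ℝ) (c : EuclideanSpace ℝ (Fin n)) (R : ℝ)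
    (hLip : ∀ j, ∃ M : NNReal, LipschitzOnWith M (a j) (Set.Icc (0 : ℝ) (2 * Real.pi)))
    (hper : ∀ j, a j 0 = a j (2 * Real.pi))
    (hSlater : TrigSIP.Slater (fun j => a (Fin.succ j)) (a 0))
    (hneg : ∃ (x : EuclideanSpace ℝ (Fin n)) (Q : ℝ), Q < 0 ∧
      ∀ t ∈ Set.Icc (0 : ℝ) (2 * Real.pi), ∑ j, a (Fin.succ j) t * x j ≤ Q)
    (hc : c ≠ 0)
    (hne : (TrigSIP.solutionSet c (TrigSIP.feasP a)).Nonempty)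
    (hR : ∀ x ∈ TrigSIP.solutionSet c (TrigSIP.feasP a), ‖x‖ ≤ R) :
    -- the constant entering the relaxed program exists
    (∃ A : ℝ, TrigSIP.IsTruncErrorConst a A) ∧
    -- (a)
    (∀ᶠ K : ℕ in Filter.atTop,
      TrigSIP.Slater (fun j : Fin n => TrigSIP.trunc (a j.succ) K) (TrigSIP.trunc (a 0) K)) ∧
    -- (b)
    (∀ A : ℝ, TrigSIP.IsTruncErrorConst a A → ∃ L : ℝ, 0 < L ∧ ∀ᶠ K : ℕ in Filter.atTop,
      ∀ x ∈ TrigSIP.solutionSet c (TrigSIP.feasAFP a R A K),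
        TrigSIP.IsEpsOptimal c (TrigSIP.feasP a) L (Real.log K / K) x) ∧
    -- (c)
    (∃ L : ℝ, 0 < L ∧ ∀ᶠ K : ℕ in Filter.atTop,
      ∀ x ∈ TrigSIP.solutionSet c (TrigSIP.feasFP a K),
        TrigSIP.IsEpsOptimal c (TrigSIP.feasP a) L (Real.log K / K) x) ∧
    -- (d)
    (∃ L : ℝ, 0 < L ∧ ∀ᶠ K : ℕ in Filter.atTop,
      ∀ z ∈ TrigSIP.solTFP c a K,
        TrigSIP.IsEpsOptimal c (TrigSIP.feasP a) L (Real.log K / K) z.1) := by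
  obtain ⟨A, hA⟩ := TrigSIP.exists_isTruncErrorConst hLip hper
  obtain ⟨x', Q, hQ, hx'⟩ := hneg
  have h₀ : ContinuousOn (a 0) (Set.Icc (0 : ℝ) (2 * Real.pi)) := by
    obtain ⟨M, hM⟩ := hLip 0
    exact hM.continuousOn
  obtain ⟨D, hD, hslater⟩ := TrigSIP.exists_slater_point_near_optimal hQ hx' hne hA
  obtain ⟨L, hL, hopt⟩ :=
    TrigSIP.exists_isEpsOptimal_of_almost_feasible h₀ hQ hx' hne hR hA hD
  have hFP : ∀ᶠ K : ℕ in Filter.atTop, ∀ x ∈ TrigSIP.solutionSet c (TrigSIP.feasFP a K),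
      TrigSIP.IsEpsOptimal c (TrigSIP.feasP a) L (Real.log K / K) x := by
    filter_upwards [Filter.eventually_ge_atTop 2, hslater, hopt] with K hK ⟨y, hy, hyv⟩ h x hx
    have hDε := mul_nonneg hD (TrigSIP.log_div_natCast_pos hK).le
    refine h x ((hx.2 y fun t ht => (hy t ht).le).trans hyv) fun t ht => ?_
    exact (hx.1 t ht).trans (by linarith)
  refine ⟨⟨A, hA⟩, hslater.mono fun K ⟨y, hy, _⟩ => ⟨y, hy⟩, ?_, ⟨L, hL, hFP⟩, ⟨L, hL, ?_⟩⟩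
  · intro A hA
    obtain ⟨x₀, hx₀⟩ := hne
    have hR0 := (norm_nonneg x₀).trans (hR x₀ hx₀)
    have hA0 := hA.1
    obtain ⟨L, hL, hopt⟩ := TrigSIP.exists_isEpsOptimal_of_almost_feasible h₀ hQ hx' ⟨x₀, hx₀⟩ hR hA
      (D := 2 * (n * R + 1) * A) (by positivity)
    refine ⟨L, hL, ?_⟩
    filter_upwards [Filter.eventually_ge_atTop 2, hopt] with K hK h x hx
    have hε0 := TrigSIP.log_div_natCast_pos hK
    refine h x ?_ hx.1
    have h1 := hx.2 x₀ (TrigSIP.mem_feasAFP_of_norm_le hA hK hx₀.1 (hR x₀ hx₀))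
    rw [TrigSIP.optimalValue_eq_of_mem_solutionSet hx₀]
    exact h1.trans (le_add_of_nonneg_right (by positivity))
  · filter_upwards [hFP] with K h z hz
    refine h z.1 ⟨(TrigSIP.mem_feasFP_iff a K z.1).mpr ⟨z.2, hz.1⟩, fun y hy => ?_⟩
    obtain ⟨Y, hY⟩ := (TrigSIP.mem_feasFP_iff a K y).mp hy
    exact hz.2 (y, Y) hY
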